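/- Let $n\ge 1$, let $\boldsymbol{k}=(k_1,\dots,k_m)$ be a tuple of $m\ge 2$ positive integers with $k_1+\dots+k_m=n$, and embed $\mathrm{U}(k_1)\times\dots\times\mathrm{U}(k_m)$ block diagonally in $\mathrm{U}(n)$. For $1\le j\le m$ let $\mathrm{U}(\boldsymbol{k},j,\mathbb{T})\subset \mathrm{U}(n)$ be the subgroup of all block diagonal matrices $\mathrm{diag}(A_1,\dots,A_m)$ with $A_i\in\mathrm{U}(k_i)$ for every $i$ and $A_j\in\mathbb{T}I_{k_j}$, where $\mathbb{T}$ is the unit circle in $\mathbb{C}$. For $\lambda>-1$ let $v_\lambda$ be the measure $dv_\lambda(z)=c_\lambda(1-|z|^2)^\lambda\,dv(z)$ on the open unit ball $\mathbb{B}^n\subset\mathbb{C}^n$, where $v$ is Lebesgue measure and $c_\lambda=\frac{\Gamma(n+\lambda+1)}{\pi^n\Gamma(\lambda+1)}$. Let $\mathcal{A}^2_\lambda(\mathbb{B}^n)$ be the closed subspace of $L^2(\mathbb{B}^n,v_\lambda)$ that consists of the holomorphic functions, let $B_\lambda$ be the orthogonal projection of $L^2(\mathbb{B}^n,v_\lambda)$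 onto it, and for $a\in L^\infty(\mathbb{B}^n)$ let $T^{(\lambda)}_a$ be the bounded operator $f\mapsto B_\lambda(af)$ on $\mathcal{A}^2_\lambda(\mathbb{B}^n)$. Let $j_1,j_2\in\{1,\dots,m\}$ with $j_1\neq j_2$, and let $a,b\in L^\infty(\mathbb{B}^n)$ be such that $a\circ A=a$ almost everywhere for every $A\in\mathrm{U}(\boldsymbol{k},j_1,\mathbb{T})$ and $b\circ A=b$ almost everywhere for every $A\in\mathrm{U}(\boldsymbol{k},j_2,\mathbb{T})$. Then \[ T^{(\lambda)}_a T^{(\lambda)}_b = T^{(\lambda)}_b T^{(\lambda)}_a \qquad\text{for every } \lambda>-1. \] -/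

import Mathlib

open MeasureTheory Metric Filter Topology
open scoped ENNReal

noncomputable section
namespace BallToeplitz

/-- The space `ℂⁿ` with its Euclidean norm. -/
abbrev Cn (n : ℕ) : Type := EuclideanSpace ℂ (Fin n)

/-- The open unit ball `𝔹ⁿ` of `ℂⁿ`. -/
def unitBall (n : ℕ) : Set (Cn n) := ball 0 1

/-- The normalizing constant `c_λ = Γ(n + λ + 1) / (πⁿ Γ(λ + 1))`. -/
def normConst (n : ℕ) (lam : ℝ) : ℝ :=
  Real.Gamma (n + lam + 1) / (Real.pi ^ n * Real.Gamma (lam + 1))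

/-- Lebesgue measure on the unit ball. -/
def ballVolume (n : ℕ) : Measure (Cn n) := volume.restrict (unitBall n)

/-- The weighted measure `dv_λ(z) = c_λ (1 - |z|²)^λ dv(z)` on the unit ball. -/
def bergmanMeasure (n : ℕ) (lam : ℝ) : Measure (Cn n) :=
  (ballVolume n).withDensity
    (fun z => ENNReal.ofReal (normConst n lam * (1 - ‖z‖ ^ 2) ^ lam))

/-- The weighted Bergman space `A²_λ(𝔹ⁿ)`: the elements of `L²(𝔹ⁿ, v_λ)` that are represented by a
holomorphic function on the ball. -/
def bergmanSpace (n : ℕ) (lam : ℝ) : Submodule ℂ (Lp ℂ 2 (bergmanMeasure n lam)) where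
  carrier := {F | ∃ f : Cn n → ℂ, DifferentiableOn ℂ f (unitBall n) ∧
    (F : Cn n → ℂ) =ᵐ[bergmanMeasure n lam] f}
  add_mem' := by
    rintro F G ⟨f, hf, hF⟩ ⟨g, hg, hG⟩
    exact ⟨f + g, hf.add hg, (Lp.coeFn_add F G).trans (hF.add hG)⟩
  zero_mem' := ⟨0, differentiableOn_const 0, Lp.coeFn_zero _ _ _⟩
  smul_mem' := by
    rintro c F ⟨f, hf, hF⟩
    exact ⟨c • f, hf.const_smul c, (Lp.coeFn_smul c F).trans (hF.const_smul c)⟩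

/-- Mean value inequality on a circle. -/
theorem enorm_le_lintegral_circle {n : ℕ} {f : Cn n → ℂ} {z w : Cn n} {r : ℝ}
    (hf : DifferentiableOn ℂ f (ball z r)) (hw : w ∈ ball (0 : Cn n) r) :
    ENNReal.ofReal (2 * Real.pi) * ‖f z‖ₑ ≤
      ∫⁻ θ in Set.Ioc 0 (2 * Real.pi), ‖f (z + circleMap 0 1 θ • w)‖ₑ := by
  have hmaps : ∀ ζ : ℂ, ‖ζ‖ ≤ 1 → z + ζ • w ∈ ball z r := by
    intro ζ hζ
    rw [mem_ball_zero_iff] at hw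
    simp only [mem_ball, dist_self_add_left, norm_smul]
    nlinarith [norm_nonneg w]
  have hφ : ∀ ζ : ℂ, ‖ζ‖ ≤ 1 → DifferentiableAt ℂ (fun ζ : ℂ => f (z + ζ • w)) ζ := by
    intro ζ hζ
    have h1 : DifferentiableAt ℂ f (z + ζ • w) :=
      (hf _ (hmaps ζ hζ)).differentiableAt (isOpen_ball.mem_nhds (hmaps ζ hζ))
    exact h1.comp ζ (by fun_prop)
  have hav := circleAverage_of_differentiable_on_off_countable (f := fun ζ : ℂ => f (z + ζ • w))
    (c := 0) (R := 1) Set.countable_empty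
    (fun ζ hζ => (hφ ζ (by simpa using hζ)).continuousAt.continuousWithinAt)
    (fun ζ hζ => hφ ζ (by
      have := hζ.1
      rw [mem_ball_zero_iff] at this
      simpa using this.le))
  simp only [zero_smul, add_zero] at hav
  rw [Real.circleAverage_def, intervalIntegral.integral_of_le (by positivity)] at hav
  have hpi : (0 : ℝ) < 2 * Real.pi := by positivity
  have h2 : ((2 * Real.pi : ℝ) : ℂ) * f z =
      ∫ θ in Set.Ioc 0 (2 * Real.pi), f (z + circleMap 0 1 θ • w) := by
    rw [← hav, Complex.real_smul, ← mul_assoc, ← Complex.ofReal_mul, mul_inv_cancel₀ hpi.ne']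
    simp
  calc ENNReal.ofReal (2 * Real.pi) * ‖f z‖ₑ = ‖((2 * Real.pi : ℝ) : ℂ) * f z‖ₑ := by
        rw [enorm_mul]
        congr 1
        rw [← ofReal_norm, Complex.norm_real, Real.norm_of_nonneg hpi.le]
    _ ≤ _ := by
        rw [h2]
        exact enorm_integral_le_lintegral_enorm _

/-- Mean value inequality over a ball. -/
theorem enorm_mul_volume_le {n : ℕ} {f : Cn n → ℂ} {z : Cn n} {r : ℝ}
    (hf : DifferentiableOn ℂ f (ball z r)) :
    volume (ball (0 : Cn n) r) * ‖f z‖ₑ ≤ ∫⁻ w in ball z r, ‖f w‖ₑ := by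
  classical
  set h : Cn n → ℝ≥0∞ := (ball z r).indicator (fun w => ‖f w‖ₑ) with hh
  have hmeas : Measurable h := by
    rw [hh, ← Set.piecewise_eq_indicator]
    exact hf.continuousOn.enorm.measurable_piecewise continuousOn_const measurableSet_ball
  have hpi : ENNReal.ofReal (2 * Real.pi) ≠ 0 := by
    simp [Real.pi_pos]
  have h1 : ∀ w ∈ ball (0 : Cn n) r, ENNReal.ofReal (2 * Real.pi) * ‖f z‖ₑ ≤
      ∫⁻ θ in Set.Ioc 0 (2 * Real.pi), h (z + circleMap 0 1 θ • w) := by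
    intro w hw
    refine (enorm_le_lintegral_circle hf hw).trans_eq (lintegral_congr fun θ => ?_)
    rw [hh, Set.indicator_of_mem]
    rw [mem_ball_zero_iff] at hw
    simp [mem_ball, dist_self_add_left, norm_smul, hw]
  have h3 : ∀ θ : ℝ, ∫⁻ w in ball (0 : Cn n) r, h (z + circleMap 0 1 θ • w) =
      ∫⁻ w in ball z r, ‖f w‖ₑ := by
    intro θ
    let L : Cn n ≃ₗᵢ[ℝ] Cn n :=
      { (LinearEquiv.smulOfNeZero ℂ (Cn n) (circleMap 0 1 θ) (by simp)).restrictScalars ℝ with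
        norm_map' := fun w => by
          change ‖circleMap 0 1 θ • w‖ = ‖w‖
          simp [norm_smul] }
    have hL : ∀ w, L w = circleMap 0 1 θ • w := fun w => rfl
    have e1 : ∫⁻ w in ball (0 : Cn n) r, h (z + circleMap 0 1 θ • w) =
        ∫⁻ w, h (z + L w) := by
      rw [← lintegral_indicator measurableSet_ball]
      refine lintegral_congr fun w => ?_
      by_cases hw : w ∈ ball (0 : Cn n) r
      · rw [Set.indicator_of_mem hw, hL]
      · rw [Set.indicator_of_notMem hw, hh, Set.indicator_of_notMem]
        simpa [mem_ball, dist_self_add_left] using hw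
    rw [e1, L.measurePreserving.lintegral_comp (f := fun w => h (z + w))
      (hmeas.comp (measurable_const_add z)), lintegral_add_left_eq_self h z, hh,
      lintegral_indicator measurableSet_ball]
  have h2 : ENNReal.ofReal (2 * Real.pi) * (volume (ball (0 : Cn n) r) * ‖f z‖ₑ) ≤
      ENNReal.ofReal (2 * Real.pi) * ∫⁻ w in ball z r, ‖f w‖ₑ := by
    calc ENNReal.ofReal (2 * Real.pi) * (volume (ball (0 : Cn n) r) * ‖f z‖ₑ)
        = ∫⁻ _ in ball (0 : Cn n) r, ENNReal.ofReal (2 * Real.pi) * ‖f z‖ₑ := by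
          rw [setLIntegral_const]; ring
      _ ≤ ∫⁻ w in ball (0 : Cn n) r,
            ∫⁻ θ in Set.Ioc 0 (2 * Real.pi), h (z + circleMap 0 1 θ • w) :=
          setLIntegral_mono' measurableSet_ball h1
      _ = ∫⁻ θ in Set.Ioc 0 (2 * Real.pi),
            ∫⁻ w in ball (0 : Cn n) r, h (z + circleMap 0 1 θ • w) := by
          refine lintegral_lintegral_swap (Measurable.aemeasurable ?_)
          have hc : Measurable (fun p : Cn n × ℝ => z + circleMap 0 1 p.2 • p.1) := by
            apply Continuous.measurable
            have := continuous_circleMap 0 1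
            fun_prop
          exact hmeas.comp hc
      _ = ENNReal.ofReal (2 * Real.pi) * ∫⁻ w in ball z r, ‖f w‖ₑ := by
          simp_rw [h3]
          rw [setLIntegral_const, Real.volume_Ioc, sub_zero, mul_comm]
  exact (ENNReal.mul_le_mul_iff_right hpi ENNReal.ofReal_ne_top).1 h2

/-- Point evaluations of holomorphic functions are locally uniformly bounded by the norm of
`L²(𝔹ⁿ, v_λ)`. -/
theorem exists_bound {n : ℕ} {lam : ℝ} (hc : 0 < normConst n lam) {z₀ : Cn n}
    (hz₀ : z₀ ∈ unitBall n) :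
    ∃ r > 0, ball z₀ (2 * r) ⊆ unitBall n ∧ ∃ C : ℝ, ∀ f : Cn n → ℂ,
      DifferentiableOn ℂ f (unitBall n) → MemLp f 2 (bergmanMeasure n lam) →
      ∀ z ∈ ball z₀ (2 * r), ‖f z‖ ≤ C * (eLpNorm f 2 (bergmanMeasure n lam)).toReal := by
  have hz1 : ‖z₀‖ < 1 := by simpa [unitBall] using hz₀
  set r : ℝ := (1 - ‖z₀‖) / 4 with hr
  have hr0 : 0 < r := by rw [hr]; linarith
  set ρ : ℝ := ‖z₀‖ + 3 * r with hρ
  have hρ1 : ρ < 1 := by rw [hρ, hr]; linarith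
  have hsub : closedBall (0 : Cn n) ρ ⊆ unitBall n := closedBall_subset_ball hρ1
  have hsub2 : ∀ z ∈ ball z₀ (2 * r), ball z r ⊆ closedBall (0 : Cn n) ρ := by
    intro z hz w hw
    rw [mem_ball] at hz hw
    rw [mem_closedBall, dist_zero_right]
    have h1 := dist_triangle w z z₀
    have h2 := norm_le_norm_add_norm_sub z₀ w
    rw [norm_sub_rev, ← dist_eq_norm] at h2
    linarith
  refine ⟨r, hr0, fun z hz => hsub (hsub2 z hz (mem_ball_self hr0)), ?_⟩
  -- lower bound of the density
  obtain ⟨δ, hδ0, hδ⟩ : ∃ δ > 0, ∀ z ∈ closedBall (0 : Cn n) ρ,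
      δ ≤ normConst n lam * (1 - ‖z‖ ^ 2) ^ lam := by
    have hcont : ContinuousOn (fun z : Cn n => normConst n lam * (1 - ‖z‖ ^ 2) ^ lam)
        (closedBall (0 : Cn n) ρ) := by
      refine continuousOn_const.mul (ContinuousOn.rpow_const (by fun_prop) fun z hz => Or.inl ?_)
      rw [mem_closedBall, dist_zero_right] at hz
      nlinarith [norm_nonneg z]
    have hne : (closedBall (0 : Cn n) ρ).Nonempty :=
      ⟨0, by simp only [mem_closedBall, dist_self]; rw [hρ]; positivity⟩
    obtain ⟨z, hz, hmin⟩ := (isCompact_closedBall (0 : Cn n) ρ).exists_isMinOn hne hcont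
    refine ⟨_, mul_pos hc (Real.rpow_pos_of_pos ?_ lam), hmin⟩
    rw [mem_closedBall, dist_zero_right] at hz
    nlinarith [norm_nonneg z]
  have hδ' : ENNReal.ofReal δ ≠ 0 := by simpa using hδ0
  have hmeas : (volume.restrict (closedBall (0 : Cn n) ρ)) ≤
      (ENNReal.ofReal δ)⁻¹ • bergmanMeasure n lam := by
    refine Measure.le_iff.2 fun s hs => ?_
    rw [Measure.restrict_apply hs, Measure.smul_apply, smul_eq_mul, mul_comm, ← div_eq_mul_inv,
      ENNReal.le_div_iff_mul_le (Or.inl hδ') (Or.inl ENNReal.ofReal_ne_top)]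
    rw [bergmanMeasure, withDensity_apply _ hs, ballVolume, Measure.restrict_restrict hs]
    calc volume (s ∩ closedBall (0 : Cn n) ρ) * ENNReal.ofReal δ
        = ∫⁻ _ in s ∩ closedBall (0 : Cn n) ρ, ENNReal.ofReal δ := by
          rw [setLIntegral_const, mul_comm]
      _ ≤ ∫⁻ z in s ∩ closedBall (0 : Cn n) ρ,
            ENNReal.ofReal (normConst n lam * (1 - ‖z‖ ^ 2) ^ lam) :=
          setLIntegral_mono' (hs.inter measurableSet_closedBall)
            fun z hz => ENNReal.ofReal_le_ofReal (hδ z hz.2)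
      _ ≤ _ := lintegral_mono_set (Set.inter_subset_inter_right s hsub)
  set V : ℝ≥0∞ := volume (ball (0 : Cn n) r) with hV
  have hV0 : V ≠ 0 := (measure_ball_pos volume _ hr0).ne'
  have hVt : V ≠ ∞ := measure_ball_lt_top.ne
  set K : ℝ≥0∞ := V⁻¹ * ((ENNReal.ofReal δ)⁻¹ ^ (1 / (2 : ℝ)) * V ^ (1 / (2 : ℝ))) with hK
  have hKt : K ≠ ∞ := by
    refine ENNReal.mul_ne_top (ENNReal.inv_ne_top.2 hV0) (ENNReal.mul_ne_top ?_ ?_)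
    · exact ENNReal.rpow_ne_top_of_nonneg (by norm_num) (ENNReal.inv_ne_top.2 hδ')
    · exact ENNReal.rpow_ne_top_of_nonneg (by norm_num) hVt
  refine ⟨K.toReal, fun f hf hfm z hz => ?_⟩
  have hballz : ball z r ⊆ unitBall n := (hsub2 z hz).trans hsub
  have hfz : DifferentiableOn ℂ f (ball z r) := hf.mono hballz
  have haes : AEStronglyMeasurable f (volume.restrict (ball z r)) :=
    hfz.continuousOn.aestronglyMeasurable measurableSet_ball
  have key : ‖f z‖ₑ ≤ K * eLpNorm f 2 (bergmanMeasure n lam) := by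
    have s1 : V * ‖f z‖ₑ ≤ eLpNorm f 1 (volume.restrict (ball z r)) := by
      rw [eLpNorm_one_eq_lintegral_enorm]
      exact enorm_mul_volume_le hfz
    have s2 := eLpNorm_le_eLpNorm_mul_rpow_measure_univ (p := 1) (q := 2)
      (by norm_num) haes
    have s3 : eLpNorm f 2 (volume.restrict (ball z r)) ≤
        (ENNReal.ofReal δ)⁻¹ ^ (1 / (2 : ℝ)) * eLpNorm f 2 (bergmanMeasure n lam) := by
      refine (eLpNorm_mono_measure f ((Measure.restrict_mono_set _ (hsub2 z hz)).trans
        hmeas)).trans_eq ?_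
      rw [eLpNorm_smul_measure_of_ne_top (by norm_num)]
      simp
    have s4 : (volume.restrict (ball z r)) Set.univ = V := by
      rw [Measure.restrict_apply_univ, hV, Measure.addHaar_ball_center]
    rw [s4] at s2
    have s5 : ‖f z‖ₑ = V⁻¹ * (V * ‖f z‖ₑ) := by
      rw [← mul_assoc, ENNReal.inv_mul_cancel hV0 hVt, one_mul]
    rw [s5]
    calc V⁻¹ * (V * ‖f z‖ₑ) ≤ V⁻¹ * (((ENNReal.ofReal δ)⁻¹ ^ (1 / (2 : ℝ)) *
          eLpNorm f 2 (bergmanMeasure n lam)) * V ^ (1 / (2 : ℝ))) := by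
          refine mul_le_mul_right (s1.trans (s2.trans ?_)) _
          have : (1 / (1 : ℝ≥0∞).toReal - 1 / (2 : ℝ≥0∞).toReal) = 1 / (2 : ℝ) := by norm_num
          rw [this]
          gcongr
      _ = K * eLpNorm f 2 (bergmanMeasure n lam) := by rw [hK]; ring
  have := ENNReal.toReal_mono (ENNReal.mul_ne_top hKt hfm.2.ne) key
  rwa [ENNReal.toReal_mul, toReal_enorm] at this

/-- The Bergman space is closed in `L²(𝔹ⁿ, v_λ)`, so that it has an orthogonal projection. -/
theorem bergmanSpace_isClosed (n : ℕ) (lam : ℝ) :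
    IsClosed (bergmanSpace n lam : Set (Lp ℂ 2 (bergmanMeasure n lam))) := by
  rcases le_or_gt (normConst n lam) 0 with hc | hc
  · have h0 : bergmanMeasure n lam = 0 := by
      rw [bergmanMeasure, ← withDensity_zero (μ := ballVolume n)]
      refine withDensity_congr_ae ?_
      filter_upwards [ae_restrict_mem (measurableSet_ball : MeasurableSet (unitBall n))] with z hz
      have hz1 : ‖z‖ < 1 := by simpa [unitBall] using hz
      refine ENNReal.ofReal_of_nonpos (mul_nonpos_of_nonpos_of_nonneg hc ?_)
      exact Real.rpow_nonneg (by nlinarith [norm_nonneg z]) _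
    have : (bergmanSpace n lam : Set (Lp ℂ 2 (bergmanMeasure n lam))) = Set.univ := by
      refine Set.eq_univ_of_forall fun F => ⟨0, differentiableOn_const 0, ?_⟩
      have hac : bergmanMeasure n lam ≪ 0 := Measure.absolutelyContinuous_of_eq h0
      exact hac.ae_le (by simp)
    rw [this]
    exact isClosed_univ
  refine IsSeqClosed.isClosed fun u F hu hF => ?_
  choose f hfd hfe using hu
  have hmem : ∀ i, MemLp (f i) 2 (bergmanMeasure n lam) := fun i =>
    (memLp_congr_ae (hfe i)).1 (Lp.memLp (u i))
  have hdiff : ∀ i j, (eLpNorm (f i - f j) 2 (bergmanMeasure n lam)).toReal = ‖u i - u j‖ := by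
    intro i j
    rw [Lp.norm_def]
    congr 1
    refine eLpNorm_congr_ae ?_
    exact ((Lp.coeFn_sub (u i) (u j)).trans ((hfe i).sub (hfe j))).symm
  have hcau := Metric.cauchySeq_iff.1 hF.cauchySeq
  -- local uniform Cauchy estimates
  have hloc : ∀ z₀ ∈ unitBall n, ∃ r > 0, ball z₀ (2 * r) ⊆ unitBall n ∧ ∀ ε > 0, ∃ N, ∀ i ≥ N,
      ∀ j ≥ N, ∀ z ∈ ball z₀ (2 * r), ‖f i z - f j z‖ ≤ ε := by
    intro z₀ hz₀
    obtain ⟨r, hr, hsub, C, hC⟩ := exists_bound hc hz₀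
    refine ⟨r, hr, hsub, fun ε hε => ?_⟩
    obtain ⟨N, hN⟩ := hcau (ε / (|C| + 1)) (by positivity)
    refine ⟨N, fun i hi j hj z hz => ?_⟩
    have h1 := hC (f i - f j) ((hfd i).sub (hfd j)) ((hmem i).sub (hmem j)) z hz
    rw [hdiff, ← dist_eq_norm] at h1
    have h2 := (hN i hi j hj).le
    calc ‖f i z - f j z‖ ≤ C * dist (u i) (u j) := h1
      _ ≤ (|C| + 1) * (ε / (|C| + 1)) := by
          gcongr
          linarith [le_abs_self C]
      _ = ε := by field_simp
  -- the pointwise limit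
  have hlim : ∀ z ∈ unitBall n, ∃ y, Tendsto (fun i => f i z) atTop (𝓝 y) := by
    intro z hz
    obtain ⟨r, hr, -, h⟩ := hloc z hz
    refine cauchySeq_tendsto_of_complete (Metric.cauchySeq_iff.2 fun ε hε => ?_)
    obtain ⟨N, hN⟩ := h (ε / 2) (by positivity)
    refine ⟨N, fun i hi j hj => ?_⟩
    rw [dist_eq_norm]
    have := hN i hi j hj z (mem_ball_self (by positivity))
    linarith
  choose! g hg using hlim
  refine ⟨g, fun z₀ hz₀ => ?_, ?_⟩
  · obtain ⟨r, hr, hsub, h⟩ := hloc z₀ hz₀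
    have hder : ∀ ε > 0, ∃ N, ∀ i ≥ N, ∀ j ≥ N, ∀ z ∈ ball z₀ r,
        ‖fderiv ℂ (f i) z - fderiv ℂ (f j) z‖ ≤ ε := by
      intro ε hε
      obtain ⟨N, hN⟩ := h (ε * r / 2) (by positivity)
      refine ⟨N, fun i hi j hj z hz => ?_⟩
      have hzr : ball z r ⊆ ball z₀ (2 * r) := by
        refine ball_subset_ball' ?_
        rw [mem_ball] at hz
        linarith
      have hzb : unitBall n ∈ 𝓝 z :=
        isOpen_ball.mem_nhds (hsub (hzr (mem_ball_self hr)))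
      rw [← fderiv_sub ((hfd i).differentiableAt hzb) ((hfd j).differentiableAt hzb)]
      have := Complex.norm_fderiv_le_div_of_mapsTo_ball (f := f i - f j) (c := z) (R₁ := r)
        (R₂ := ε * r) (((hfd i).sub (hfd j)).mono (hzr.trans hsub)) (fun w hw => ?_) hr
      · rwa [mul_div_assoc, div_self hr.ne', mul_one] at this
      · rw [mem_closedBall, dist_eq_norm]
        have h1 := hN i hi j hj w (hzr hw)
        have h2 := hN i hi j hj z (hzr (mem_ball_self hr))
        have h3 := norm_sub_le (f i w - f j w) (f i z - f j z)
        simp only [Pi.sub_apply]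
        linarith
    have hlim' : ∀ z ∈ ball z₀ r, ∃ y, Tendsto (fun i => fderiv ℂ (f i) z) atTop (𝓝 y) := by
      intro z hz
      refine cauchySeq_tendsto_of_complete (Metric.cauchySeq_iff.2 fun ε hε => ?_)
      obtain ⟨N, hN⟩ := hder (ε / 2) (by positivity)
      refine ⟨N, fun i hi j hj => ?_⟩
      rw [dist_eq_norm]
      have := hN i hi j hj z hz
      linarith
    choose! g' hg' using hlim'
    have hunif : TendstoUniformlyOn (fun i => fderiv ℂ (f i)) g' atTop (ball z₀ r) := by
      refine UniformCauchySeqOn.tendstoUniformlyOn_of_tendsto ?_ hg'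
      rw [Metric.uniformCauchySeqOn_iff]
      intro ε hε
      obtain ⟨N, hN⟩ := hder (ε / 2) (by positivity)
      refine ⟨N, fun i hi j hj z hz => ?_⟩
      rw [dist_eq_norm]
      have := hN i hi j hj z hz
      linarith
    have hrr : ball z₀ r ⊆ unitBall n := (ball_subset_ball (by linarith)).trans hsub
    exact (hasFDerivAt_of_tendstoUniformlyOn isOpen_ball hunif
      (fun i z hz => ((hfd i).differentiableAt
        (isOpen_ball.mem_nhds (hrr hz))).hasFDerivAt)
      (fun z hz => hg z (hrr hz)) (mem_ball_self hr)).differentiableAt.differentiableWithinAt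
  · obtain ⟨ns, hns, hae⟩ := (tendstoInMeasure_of_tendsto_Lp hF).exists_seq_tendsto_ae
    have hball : ∀ᵐ z ∂(bergmanMeasure n lam), z ∈ unitBall n :=
      (withDensity_absolutelyContinuous _ _ : bergmanMeasure n lam ≪ ballVolume n).ae_le
        (ae_restrict_mem (measurableSet_ball : MeasurableSet (unitBall n)))
    filter_upwards [hae, hball, ae_all_iff.2 hfe] with z h1 h2 h3
    refine tendsto_nhds_unique h1 ?_
    simp_rw [h3]
    exact (hg z h2).comp hns.tendsto_atTop

instance (n : ℕ) (lam : ℝ) : CompleteSpace (bergmanSpace n lam) :=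
  (bergmanSpace_isClosed n lam).completeSpace_coe

/-- The symbols: the space `L^∞(𝔹ⁿ)` with respect to Lebesgue measure. -/
abbrev BallSymbol (n : ℕ) : Type := Lp ℂ ∞ (ballVolume n)

/-- A symbol is also essentially bounded with respect to each weighted measure. -/
theorem BallSymbol.memLp {n : ℕ} (a : BallSymbol n) (lam : ℝ) :
    MemLp a ∞ (bergmanMeasure n lam) :=
  have hac : bergmanMeasure n lam ≪ ballVolume n := withDensity_absolutelyContinuous _ _
  ⟨(Lp.memLp a).1.mono_ac hac, by
    have h := (Lp.memLp a).2
    rw [eLpNorm_exponent_top] at h ⊢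
    exact (essSup_mono_measure hac).trans_lt h⟩

/-- The multiplication operator `f ↦ a f` on `L²(𝔹ⁿ, v_λ)`. -/
def mulSymbol {n : ℕ} (lam : ℝ) (a : BallSymbol n) :
    Lp ℂ 2 (bergmanMeasure n lam) →L[ℂ] Lp ℂ 2 (bergmanMeasure n lam) :=
  (ContinuousLinearMap.mul ℂ ℂ).holderL (bergmanMeasure n lam) ∞ 2 2 ((a.memLp lam).toLp a)

/-- The Bergman projection `B_λ`: the orthogonal projection of `L²(𝔹ⁿ, v_λ)` onto the Bergman
space. -/
def bergmanProjection (n : ℕ) (lam : ℝ) :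
    Lp ℂ 2 (bergmanMeasure n lam) →L[ℂ] bergmanSpace n lam :=
  (bergmanSpace n lam).orthogonalProjectionOnto

/-- The Toeplitz operator `T_a f = B_λ (a f)` on the Bergman space. -/
def toeplitz {n : ℕ} (lam : ℝ) (a : BallSymbol n) :
    bergmanSpace n lam →L[ℂ] bergmanSpace n lam :=
  bergmanProjection n lam ∘L mulSymbol lam a ∘L (bergmanSpace n lam).subtypeL

/-- A symbol `a` is invariant under a group `H` of unitary matrices if `a ∘ A = a` in `L^∞(𝔹ⁿ)`,
that is almost everywhere, for every `A ∈ H`. -/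
def IsInvariantSymbol {n : ℕ} (H : Subgroup (Matrix.unitaryGroup (Fin n) ℂ))
    (a : BallSymbol n) : Prop :=
  ∀ A ∈ H, (fun z : Cn n =>
    a (Matrix.toEuclideanCLM (𝕜 := ℂ) (A : Matrix (Fin n) (Fin n) ℂ) z)) =ᵐ[ballVolume n] a

/-- The homomorphism `t ↦ t I` from the circle group to `U(d)`. -/
def scalarEmbed (d : ℕ) : Circle →* Matrix.unitaryGroup (Fin d) ℂ where
  toFun t := ⟨(t : ℂ) • (1 : Matrix (Fin d) (Fin d) ℂ), by
    rw [Matrix.mem_unitaryGroup_iff, star_smul, star_one, smul_mul_smul_comm, one_mul]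
    have : (t : ℂ) * star (t : ℂ) = 1 := by
      rw [← starRingEnd_apply, Complex.mul_conj, Circle.normSq_coe, Complex.ofReal_one]
    rw [this, one_smul]⟩
  map_one' := by
    apply Subtype.ext
    simp
  map_mul' s t := by
    apply Subtype.ext
    simp [smul_smul, mul_comm]

/-- For `k = (k₁, …, k_m)` with sum `n`, the block diagonal embedding of `U(k₁) × ⋯ × U(k_m)` in
`U(n)`. The blocks are consecutive, of sizes `k₁, …, k_m` in this order. -/
def blockEmbed {n : ℕ} (k : Composition n) :
    (∀ i : Fin k.length, Matrix.unitaryGroup (Fin (k.blocksFun i)) ℂ) →*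
      Matrix.unitaryGroup (Fin n) ℂ where
  toFun A := ⟨Matrix.reindex k.blocksFinEquiv k.blocksFinEquiv
      (Matrix.blockDiagonal' fun i => (A i : Matrix (Fin (k.blocksFun i)) (Fin (k.blocksFun i)) ℂ)),
    by
    rw [Matrix.mem_unitaryGroup_iff, Matrix.star_eq_conjTranspose, Matrix.reindex_apply,
      Matrix.conjTranspose_submatrix, Matrix.submatrix_mul_equiv,
      Matrix.blockDiagonal'_conjTranspose, ← Matrix.blockDiagonal'_mul]
    have h : ∀ i, (A i : Matrix (Fin (k.blocksFun i)) (Fin (k.blocksFun i)) ℂ) *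
        (A i : Matrix (Fin (k.blocksFun i)) (Fin (k.blocksFun i)) ℂ).conjTranspose = 1 :=
      fun i => Matrix.mem_unitaryGroup_iff.1 (A i).2
    simp_rw [h]
    erw [Matrix.blockDiagonal'_one]
    simp⟩
  map_one' := by
    apply Subtype.ext
    simp only [Pi.one_apply, Matrix.UnitaryGroup.one_val]
    erw [Matrix.blockDiagonal'_one]
    simp
  map_mul' A B := by
    apply Subtype.ext
    simp [Matrix.submatrix_mul_equiv, Matrix.blockDiagonal'_mul]

/-- The group `U(k, j, 𝕋)`: the block diagonal matrices `diag(A₁, …, A_m)` with `A_i ∈ U(k_i)` for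
all `i` and `A_j ∈ 𝕋 I`. -/
def blockGroup {n : ℕ} (k : Composition n) (j : Fin k.length) :
    Subgroup (Matrix.unitaryGroup (Fin n) ℂ) :=
  (Subgroup.pi {j} fun i => (scalarEmbed (k.blocksFun i)).range).map (blockEmbed k)

end BallToeplitz

end

open BallToeplitz

/-!
For a symbol `a` the form `(p, q) ↦ ∫ conj p · a · q dv_λ` (`symbolForm`) on monomials `z ^ α` gives
the matrix of the Toeplitz operator, since the monomials are a complete orthogonal system of the
Bergman space. A symbol invariant under `U(k, j₁, 𝕋)` has two properties.

* Torus invariance makes its form vanish on `(z ^ α, z ^ β)` unless `α` and `β` agree off the block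
  `j₁` and have the same total degree in it (`symbolForm_mon_eq_zero`). So the operator changes the
  exponents in the block `j₁` only.
* Let `s` be another block, such as that of `j₂`. The full unitary group of `s` leaves `a` invariant
  and acts irreducibly on the homogeneous polynomials of given degree in the coordinates of `s`, so
  the operator should depend on the exponents in `s` through their sum only. Instead of Schur's
  lemma a single unitary matrix `mixUnitary s`, whose entries in the block `s` are all nonzero, is
  used: it takes a power of one coordinate to a sum of all monomials of this degree with nonzero
  coefficients. Moving it from one argument of the form to the other, and discarding the terms that
  vanish by torus invariance, gives `exists_symbolForm_eq`: a change of the exponents in `s` (with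
  the same sum) multiplies the form by a factor that is the same for all symbols, in particular for
  the symbol `1`, whose form is the inner product.

The same holds for `b` with `j₁` and `j₂` exchanged. The matrix entry of a product of the two
operators from `α` to `γ` is then a single product of entries, which passes through the exponents
that agree with `γ` on one of the two blocks and with `α` elsewhere. The entries met on the two
paths agree up to these factors, which cancel against the norms of the monomials
(`toeplitz_comm_of_invariantUnder`).

Completeness of the monomials (`eqOn_zero_of_integral_conj_mon_eq_zero`) is obtained without power
series in several variables. A holomorphic function on the ball is projected to its homogeneous
component in one coordinate after the other (`coordComponent`), with degrees chosen such that the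
value at a given point stays nonzero; the result is holomorphic by differentiation under the
integral, is a multiple of a monomial, and has the same inner product with this monomial as the
original function because the measure is invariant under rotations of the coordinates.
-/

open scoped ComplexConjugate

noncomputable section
namespace BallToeplitz

/-! ### The weighted measure -/

theorem normConst_pos (n : ℕ) {lam : ℝ} (hlam : -1 < lam) : 0 < normConst n lam := by
  have hn : (0 : ℝ) ≤ n := n.cast_nonneg
  exact div_pos (Real.Gamma_pos_of_pos (by linarith))
    (mul_pos (by positivity) (Real.Gamma_pos_of_pos (by linarith)))

theorem bergmanMeasure_absolutelyContinuous (n : ℕ) (lam : ℝ) :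
    bergmanMeasure n lam ≪ ballVolume n :=
  withDensity_absolutelyContinuous _ _

theorem measurableSet_unitBall (n : ℕ) : MeasurableSet (unitBall n) := measurableSet_ball

theorem mem_unitBall {n : ℕ} {z : Cn n} : z ∈ unitBall n ↔ ‖z‖ < 1 := by
  simp [unitBall]

theorem ae_mem_unitBall (n : ℕ) (lam : ℝ) : ∀ᵐ z ∂(bergmanMeasure n lam), z ∈ unitBall n :=
  (bergmanMeasure_absolutelyContinuous n lam).ae_le (ae_restrict_mem (measurableSet_unitBall n))

theorem measurable_density (n : ℕ) (lam : ℝ) : Measurable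
    (fun z : Cn n => ENNReal.ofReal (normConst n lam * (1 - ‖z‖ ^ 2) ^ lam)) := by
  fun_prop

/-- For `λ > -1` the weight is integrable: in polar coordinates it is dominated by a multiple of
`(1 - r) ^ λ` on `(0, 1)`. -/
theorem isFiniteMeasure_bergmanMeasure {n : ℕ} (hn : n ≠ 0) {lam : ℝ} (hlam : -1 < lam) :
    IsFiniteMeasure (bergmanMeasure n lam) := by
  have : NeZero n := ⟨hn⟩
  have key : IntegrableOn (fun z : Cn n => normConst n lam * (1 - ‖z‖ ^ 2) ^ lam)
      (ball (0 : Cn n) 1) volume := by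
    rw [integrableOn_fun_norm_addHaar volume
      (f := fun r : ℝ => normConst n lam * (1 - r ^ 2) ^ lam)]
    have h1 : IntegrableOn (fun r : ℝ => (1 - r) ^ lam) (Set.Ioo 0 1) := by
      have h := (intervalIntegral.intervalIntegrable_rpow' (a := 0) (b := 1) hlam).comp_sub_left 1
      simp only [sub_zero, sub_self] at h
      exact (intervalIntegrable_iff_integrableOn_Ioo_of_le zero_le_one).1 h.symm
    have hbd : ∀ r ∈ Set.Ioo (0 : ℝ) 1,
        ‖r ^ (Module.finrank ℝ (Cn n) - 1) • (normConst n lam * (1 + r) ^ lam)‖ ≤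
          normConst n lam * max 1 (2 ^ lam) := by
      rintro r ⟨h0, h1⟩
      have hc := (normConst_pos n hlam).le
      have h2 : (0 : ℝ) ≤ (1 + r) ^ lam := Real.rpow_nonneg (by linarith) _
      have h3 : (1 + r) ^ lam ≤ max 1 (2 ^ lam) := by
        rcases le_total 0 lam with h | h
        · exact (Real.rpow_le_rpow (by linarith) (by linarith) h).trans (le_max_right _ _)
        · exact (Real.rpow_le_one_of_one_le_of_nonpos (by linarith) h).trans (le_max_left _ _)
      rw [smul_eq_mul, Real.norm_of_nonneg (by positivity)]
      calc _ ≤ 1 * (normConst n lam * (1 + r) ^ lam) := by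
            gcongr
            exact pow_le_one₀ h0.le h1.le
        _ ≤ _ := by rw [one_mul]; gcongr
    have h2 := Integrable.bdd_mul (c := normConst n lam * max 1 (2 ^ lam)) h1
      (f := fun r : ℝ => r ^ (Module.finrank ℝ (Cn n) - 1) • (normConst n lam * (1 + r) ^ lam))
      (by
        apply Measurable.aestronglyMeasurable
        fun_prop) ((ae_restrict_iff' measurableSet_Ioo).2 (Eventually.of_forall hbd))
    refine h2.congr ((ae_restrict_iff' measurableSet_Ioo).2 (Eventually.of_forall ?_))
    rintro r ⟨h0, h1⟩
    have : (1 : ℝ) - r ^ 2 = (1 + r) * (1 - r) := by ring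
    simp only [smul_eq_mul, this]
    rw [Real.mul_rpow (by linarith) (by linarith)]
    ring
  exact isFiniteMeasure_withDensity_ofReal key.2

theorem measurePreserving_linearIsometryEquiv {n : ℕ} (lam : ℝ) (L : Cn n ≃ₗᵢ[ℂ] Cn n) :
    MeasurePreserving L (bergmanMeasure n lam) (bergmanMeasure n lam) := by
  have hL : Measurable L := L.continuous.measurable
  refine ⟨hL, Measure.ext fun s hs => ?_⟩
  have hvol : MeasurePreserving L (volume : Measure (Cn n)) volume :=
    LinearIsometryEquiv.measurePreserving
      { L.toLinearEquiv.restrictScalars ℝ with norm_map' := L.norm_map }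
  have hball : L ⁻¹' unitBall n = unitBall n := by
    ext z
    simp [unitBall]
  have hr : MeasurePreserving L (ballVolume n) (ballVolume n) := by
    have := hvol.restrict_preimage (measurableSet_unitBall n)
    rwa [hball] at this
  rw [Measure.map_apply hL hs, bergmanMeasure, withDensity_apply _ (hL hs), withDensity_apply _ hs,
    ← hr.setLIntegral_comp_preimage hs (measurable_density n lam)]
  simp

theorem ae_ballVolume_of_ae_bergmanMeasure {n : ℕ} {lam : ℝ} (hlam : -1 < lam) {p : Cn n → Prop}
    (h : ∀ᵐ z ∂(bergmanMeasure n lam), p z) : ∀ᵐ z ∂(ballVolume n), p z := by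
  rw [bergmanMeasure, ae_withDensity_iff (measurable_density n lam)] at h
  filter_upwards [h, ae_restrict_mem (measurableSet_unitBall n)] with z hz hzb
  refine hz ?_
  rw [mem_unitBall] at hzb
  rw [Ne, ENNReal.ofReal_eq_zero, not_le]
  exact mul_pos (normConst_pos n hlam) (Real.rpow_pos_of_pos (by nlinarith [norm_nonneg z]) _)

theorem eqOn_unitBall_of_ae_eq {n : ℕ} {lam : ℝ} (hlam : -1 < lam) {f g : Cn n → ℂ}
    (hf : ContinuousOn f (unitBall n)) (hg : ContinuousOn g (unitBall n))
    (h : f =ᵐ[bergmanMeasure n lam] g) : Set.EqOn f g (unitBall n) :=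
  Measure.eqOn_open_of_ae_eq (μ := volume) (ae_ballVolume_of_ae_bergmanMeasure hlam h)
    isOpen_ball hf hg

/-! ### Monomials and the sesquilinear form of a symbol -/

/-- The monomial `z ↦ ∏ᵢ zᵢ ^ αᵢ` on `ℂⁿ`. -/
def mon {n : ℕ} (α : Fin n → ℕ) (z : Cn n) : ℂ := ∏ i, z i ^ α i

theorem continuous_mon {n : ℕ} (α : Fin n → ℕ) : Continuous (mon α) := by
  unfold mon
  fun_prop

theorem differentiable_mon {n : ℕ} (α : Fin n → ℕ) : Differentiable ℂ (mon α) := by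
  unfold mon
  fun_prop

/-- The sesquilinear form `(p, q) ↦ ∫ conj p · a · q dv_λ` of a symbol `a`. For `a = 1` it is the
inner product of `L²(𝔹ⁿ, v_λ)`, and for polynomials `p` and `q` it gives the matrix entries of the
Toeplitz operator of `a`. -/
def symbolForm {n : ℕ} (lam : ℝ) (a p q : Cn n → ℂ) : ℂ :=
  ∫ z, conj (p z) * (a z * q z) ∂(bergmanMeasure n lam)

/-- Composition of the symbol with the unitary matrix `A` leaves it unchanged almost everywhere. -/
def InvariantUnder {n : ℕ} (lam : ℝ) (A : Matrix.unitaryGroup (Fin n) ℂ) (a : Cn n → ℂ) : Prop :=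
  (fun z => a (Matrix.toEuclideanCLM (𝕜 := ℂ) (A : Matrix (Fin n) (Fin n) ℂ) z))
    =ᵐ[bergmanMeasure n lam] a

theorem exists_linearIsometryEquiv {n : ℕ} (A : Matrix.unitaryGroup (Fin n) ℂ) :
    ∃ L : Cn n ≃ₗᵢ[ℂ] Cn n, ∀ z,
      L z = Matrix.toEuclideanCLM (𝕜 := ℂ) (A : Matrix (Fin n) (Fin n) ℂ) z :=
  ⟨Unitary.linearIsometryEquiv
    ⟨Matrix.toEuclideanCLM (𝕜 := ℂ) (A : Matrix (Fin n) (Fin n) ℂ), Unitary.map_mem _ A.2⟩,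
    fun _ => rfl⟩

theorem symbolForm_comp {n : ℕ} {lam : ℝ} {A : Matrix.unitaryGroup (Fin n) ℂ} {a : Cn n → ℂ}
    (ha : InvariantUnder lam A a) (p q : Cn n → ℂ) :
    symbolForm lam a
      (fun z => p (Matrix.toEuclideanCLM (𝕜 := ℂ) (A : Matrix (Fin n) (Fin n) ℂ) z))
      (fun z => q (Matrix.toEuclideanCLM (𝕜 := ℂ) (A : Matrix (Fin n) (Fin n) ℂ) z)) =
    symbolForm lam a p q := by
  obtain ⟨L, hL⟩ := exists_linearIsometryEquiv A
  simp only [InvariantUnder, ← hL] at ha ⊢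
  unfold symbolForm
  rw [← (measurePreserving_linearIsometryEquiv lam L).integral_comp
    L.toHomeomorph.measurableEmbedding fun z => conj (p z) * (a z * q z)]
  refine integral_congr_ae ?_
  filter_upwards [ha] with z hz
  rw [hz]

/-- A continuous function is bounded on the ball, hence almost everywhere. -/
theorem exists_bound_of_continuous {n : ℕ} (lam : ℝ) {p : Cn n → ℂ} (hp : Continuous p) :
    ∃ C, ∀ᵐ z ∂(bergmanMeasure n lam), ‖p z‖ ≤ C := by
  obtain ⟨C, hC⟩ := (isCompact_closedBall (0 : Cn n) 1).exists_bound_of_continuousOn hp.continuousOn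
  refine ⟨C, ?_⟩
  filter_upwards [ae_mem_unitBall n lam] with z hz
  exact hC z (ball_subset_closedBall hz)

theorem integrable_symbolForm {n : ℕ} (hn : n ≠ 0) {lam : ℝ} (hlam : -1 < lam)
    {a p q : Cn n → ℂ} (ha : MemLp a ∞ (bergmanMeasure n lam)) (hp : Continuous p)
    (hq : Continuous q) :
    Integrable (fun z => conj (p z) * (a z * q z)) (bergmanMeasure n lam) := by
  have := isFiniteMeasure_bergmanMeasure hn hlam
  obtain ⟨C, hC⟩ := exists_bound_of_continuous lam hp
  obtain ⟨D, hD⟩ := exists_bound_of_continuous lam hq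
  refine Integrable.bdd_mul (c := C) ?_ (by fun_prop) ?_
  · refine Integrable.mul_bdd (c := D) (ha.integrable le_top) (by fun_prop) hD
  · filter_upwards [hC] with z hz
    simpa using hz

theorem symbolForm_sum_right {n : ℕ} (hn : n ≠ 0) {lam : ℝ} (hlam : -1 < lam) {ι : Type*}
    (s : Finset ι) (c : ι → ℂ) {a p : Cn n → ℂ} {q : ι → Cn n → ℂ}
    (ha : MemLp a ∞ (bergmanMeasure n lam)) (hp : Continuous p) (hq : ∀ i, Continuous (q i)) :
    symbolForm lam a p (fun z => ∑ i ∈ s, c i * q i z) =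
      ∑ i ∈ s, c i * symbolForm lam a p (q i) := by
  unfold symbolForm
  simp_rw [← integral_const_mul]
  rw [← integral_finsetSum s fun i _ => (integrable_symbolForm hn hlam ha hp (hq i)).const_mul _]
  refine integral_congr_ae (Eventually.of_forall fun z => ?_)
  simp only [Finset.mul_sum]
  exact Finset.sum_congr rfl fun i _ => by ring

theorem symbolForm_sum_left {n : ℕ} (hn : n ≠ 0) {lam : ℝ} (hlam : -1 < lam) {ι : Type*}
    (s : Finset ι) (c : ι → ℂ) {a q : Cn n → ℂ} {p : ι → Cn n → ℂ}
    (ha : MemLp a ∞ (bergmanMeasure n lam)) (hp : ∀ i, Continuous (p i)) (hq : Continuous q) :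
    symbolForm lam a (fun z => ∑ i ∈ s, c i * p i z) q =
      ∑ i ∈ s, conj (c i) * symbolForm lam a (p i) q := by
  unfold symbolForm
  simp_rw [← integral_const_mul]
  rw [← integral_finsetSum s fun i _ => (integrable_symbolForm hn hlam ha (hp i) hq).const_mul _]
  refine integral_congr_ae (Eventually.of_forall fun z => ?_)
  simp only [map_sum, map_mul, Finset.sum_mul]
  exact Finset.sum_congr rfl fun i _ => by ring

/-! ### Torus invariance -/

/-- The diagonal unitary matrix with entries `t i`. -/
def diagUnitary {n : ℕ} (t : Fin n → Circle) : Matrix.unitaryGroup (Fin n) ℂ :=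
  ⟨Matrix.diagonal fun i => (t i : ℂ), by
    rw [Matrix.mem_unitaryGroup_iff, Matrix.star_eq_conjTranspose, Matrix.diagonal_conjTranspose,
      Matrix.diagonal_mul_diagonal, ← Matrix.diagonal_one]
    congr 1
    ext i
    simp [Complex.mul_conj]⟩

theorem diagUnitary_apply {n : ℕ} (t : Fin n → Circle) (z : Cn n) (i : Fin n) :
    Matrix.toEuclideanCLM (𝕜 := ℂ) (diagUnitary t : Matrix (Fin n) (Fin n) ℂ) z i = t i * z i := by
  rw [Matrix.ofLp_toEuclideanCLM]
  simp [diagUnitary, Matrix.mulVec_diagonal]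

theorem mon_diagUnitary {n : ℕ} (t : Fin n → Circle) (α : Fin n → ℕ) (z : Cn n) :
    mon α (Matrix.toEuclideanCLM (𝕜 := ℂ) (diagUnitary t : Matrix (Fin n) (Fin n) ℂ) z) =
      (∏ i, (t i : ℂ) ^ α i) * mon α z := by
  simp only [mon, diagUnitary_apply, mul_pow, Finset.prod_mul_distrib]

/-- The diagonal unitary matrix with entry `c` at the places in `s` and `1` elsewhere. -/
def blockScalar {n : ℕ} (s : Finset (Fin n)) (c : Circle) : Matrix.unitaryGroup (Fin n) ℂ :=
  diagUnitary fun p => if p ∈ s then c else 1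

theorem mon_blockScalar {n : ℕ} (s : Finset (Fin n)) (c : Circle) (α : Fin n → ℕ) (z : Cn n) :
    mon α (Matrix.toEuclideanCLM (𝕜 := ℂ) (blockScalar s c : Matrix (Fin n) (Fin n) ℂ) z) =
      (c : ℂ) ^ (∑ p ∈ s, α p) * mon α z := by
  rw [blockScalar, mon_diagUnitary, ← Finset.prod_pow_eq_pow_sum]
  congr 1
  rw [← Finset.prod_subset (Finset.subset_univ s)]
  · exact Finset.prod_congr rfl fun p hp => by simp [hp]
  · intro p _ hp
    simp [hp]

theorem exists_circle_pow_ne {k l : ℕ} (h : k ≠ l) : ∃ c : Circle, (c : ℂ) ^ k ≠ (c : ℂ) ^ l := by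
  have hm : (0 : ℝ) < k + l + 1 := by positivity
  refine ⟨Circle.exp (1 / (k + l + 1)), fun hc => h ?_⟩
  have hc' : Circle.exp (k * (1 / (k + l + 1))) = Circle.exp (l * (1 / (k + l + 1))) := by
    apply Circle.ext
    simp only [Circle.coe_exp] at hc ⊢
    rw [← Complex.exp_nat_mul, ← Complex.exp_nat_mul] at hc
    convert hc using 2 <;> push_cast <;> ring
  -- both angles lie in `[0, 1)`, where the exponential is injective
  have harg : ∀ j : ℕ, (j : ℝ) ≤ k + l → Complex.arg (Circle.exp (j * (1 / (k + l + 1)))) =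
      j * (1 / (k + l + 1)) := by
    intro j hj
    apply Circle.arg_exp
    · have : (0 : ℝ) ≤ j * (1 / (k + l + 1)) := by positivity
      linarith [Real.pi_pos]
    · have : (j : ℝ) * (1 / (k + l + 1)) ≤ 1 := by
        rw [mul_one_div, div_le_one hm]
        linarith
      linarith [Real.pi_gt_three]
  have h1 := harg k (by linarith [(Nat.cast_nonneg l : (0 : ℝ) ≤ l)])
  have h2 := harg l (by linarith [(Nat.cast_nonneg k : (0 : ℝ) ≤ k)])
  rw [hc', h2] at h1
  have h3 := mul_right_cancel₀ (one_div_pos.2 hm).ne' h1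
  exact_mod_cast h3.symm

/-- If `a` is invariant under the scalars `c ∈ 𝕋` acting on the coordinates in `s`, then its form
vanishes on monomials whose total degrees in these coordinates differ. -/
theorem symbolForm_mon_eq_zero {n : ℕ} {lam : ℝ} {s : Finset (Fin n)} {a : Cn n → ℂ}
    (ha : ∀ c, InvariantUnder lam (blockScalar s c) a) {α β : Fin n → ℕ}
    (h : ∑ p ∈ s, α p ≠ ∑ p ∈ s, β p) : symbolForm lam a (mon α) (mon β) = 0 := by
  obtain ⟨c, hc⟩ := exists_circle_pow_ne h
  have h1 := symbolForm_comp (ha c) (mon α) (mon β)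
  simp only [mon_blockScalar] at h1
  set k := ∑ p ∈ s, α p
  set l := ∑ p ∈ s, β p
  have h2 : symbolForm lam a (fun z => (c : ℂ) ^ k * mon α z) (fun z => (c : ℂ) ^ l * mon β z) =
      (conj ((c : ℂ) ^ k) * (c : ℂ) ^ l) * symbolForm lam a (mon α) (mon β) := by
    unfold symbolForm
    rw [← integral_const_mul]
    refine integral_congr_ae (Eventually.of_forall fun z => ?_)
    simp only [map_mul]
    ring
  rw [h2] at h1
  by_contra h0
  have h3 : conj ((c : ℂ) ^ k) * (c : ℂ) ^ l = 1 := by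
    field_simp at h1
    exact h1
  apply hc
  have h4 : (c : ℂ) ^ k * conj ((c : ℂ) ^ k) = 1 := by
    rw [Complex.mul_conj]
    simp
  calc (c : ℂ) ^ k = (c : ℂ) ^ k * (conj ((c : ℂ) ^ k) * (c : ℂ) ^ l) := by rw [h3, mul_one]
    _ = _ := by rw [← mul_assoc, h4, one_mul]

theorem invariantUnder_one {n : ℕ} (lam : ℝ) (A : Matrix.unitaryGroup (Fin n) ℂ) :
    InvariantUnder lam A (1 : Cn n → ℂ) :=
  Filter.EventuallyEq.rfl

theorem symbolForm_one_mon_of_ne {n : ℕ} {lam : ℝ} {α β : Fin n → ℕ} (h : α ≠ β) :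
    symbolForm lam 1 (mon α) (mon β) = 0 := by
  obtain ⟨p, hp⟩ := Function.ne_iff.1 h
  exact symbolForm_mon_eq_zero (s := {p}) (fun c => invariantUnder_one lam _) (by simpa using hp)

/-- A point of the ball at which no monomial vanishes. -/
theorem const_mem_unitBall (n : ℕ) :
    WithLp.toLp 2 (fun _ : Fin n => ((n + 1 : ℝ)⁻¹ : ℂ)) ∈ unitBall n := by
  rw [mem_unitBall, ← sq_lt_one_iff₀ (norm_nonneg _), EuclideanSpace.norm_sq_eq]
  have h : (0 : ℝ) < n + 1 := by positivity
  have h' : ‖((n + 1 : ℝ)⁻¹ : ℂ)‖ = (n + 1 : ℝ)⁻¹ := by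
    rw [← Complex.ofReal_inv, Complex.norm_real, Real.norm_of_nonneg (by positivity)]
  simp only [h', Finset.sum_const, Finset.card_univ, Fintype.card_fin, nsmul_eq_mul]
  rw [inv_pow, ← div_eq_mul_inv, div_lt_one (by positivity)]
  nlinarith [(Nat.cast_nonneg n : (0 : ℝ) ≤ n)]

theorem symbolForm_one_mon_self_ne_zero {n : ℕ} (hn : n ≠ 0) {lam : ℝ} (hlam : -1 < lam)
    (α : Fin n → ℕ) : symbolForm lam 1 (mon α) (mon α) ≠ 0 := by
  have h1 : symbolForm lam 1 (mon α) (mon α) =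
      ((∫ z, ‖mon α z‖ ^ 2 ∂(bergmanMeasure n lam) : ℝ) : ℂ) := by
    rw [symbolForm, ← integral_complex_ofReal]
    refine integral_congr_ae (Eventually.of_forall fun z => ?_)
    simp [Complex.conj_mul']
  have hint : Integrable (fun z => ‖mon α z‖ ^ 2) (bergmanMeasure n lam) := by
    have := isFiniteMeasure_bergmanMeasure hn hlam
    have h := (integrable_symbolForm (lam := lam) (a := 1) hn hlam (memLp_const 1)
      (continuous_mon α) (continuous_mon α)).norm
    simpa [sq] using h
  rw [h1, Complex.ofReal_ne_zero]
  intro h0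
  rw [integral_eq_zero_iff_of_nonneg (fun z => by positivity) hint] at h0
  have h2 : mon α =ᵐ[bergmanMeasure n lam] 0 := by
    filter_upwards [h0] with z hz
    simpa using hz
  have h3 := eqOn_unitBall_of_ae_eq hlam (continuous_mon α).continuousOn continuousOn_const h2
    (const_mem_unitBall n)
  have h4 : (n + 1 : ℂ) ≠ 0 := by exact_mod_cast n.succ_ne_zero
  refine Finset.prod_ne_zero_iff.2 (fun i _ => pow_ne_zero _ ?_) h3
  simpa using h4

/-! ### Invariance under a unitary mixing of a block of coordinates -/

/-- The orthogonal projection of `ℂⁿ` onto the line spanned by the indicator vector of `s`. -/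
def avgMatrix {n : ℕ} (s : Finset (Fin n)) : Matrix (Fin n) (Fin n) ℂ :=
  Matrix.of fun p q => if p ∈ s ∧ q ∈ s then (s.card : ℂ)⁻¹ else 0

theorem avgMatrix_conjTranspose {n : ℕ} (s : Finset (Fin n)) :
    (avgMatrix s).conjTranspose = avgMatrix s := by
  ext p q
  by_cases hp : p ∈ s <;> by_cases hq : q ∈ s <;> simp [avgMatrix, hp, hq]

theorem avgMatrix_mul_self {n : ℕ} (s : Finset (Fin n)) :
    avgMatrix s * avgMatrix s = avgMatrix s := by
  ext p q
  rw [Matrix.mul_apply]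
  by_cases hp : p ∈ s <;> by_cases hq : q ∈ s <;> simp [avgMatrix, hp, hq]
  have : (s.card : ℂ) ≠ 0 := by exact_mod_cast Finset.card_ne_zero_of_mem hp
  field_simp

/-- The matrix `1 - c P`, where `P` is the orthogonal projection onto the indicator vector
of `s`. -/
def mixMatrix {n : ℕ} (s : Finset (Fin n)) (c : ℂ) : Matrix (Fin n) (Fin n) ℂ :=
  1 - c • avgMatrix s

theorem mixMatrix_mul_mixMatrix {n : ℕ} (s : Finset (Fin n)) {c d : ℂ} (h : c * d = c + d) :
    mixMatrix s c * mixMatrix s d = 1 := by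
  rw [mixMatrix, mixMatrix, mul_sub, sub_mul, sub_mul, mul_one, one_mul, smul_mul_smul_comm,
    avgMatrix_mul_self, mul_one, h, add_smul]
  abel

theorem one_sub_I_mul : (1 - Complex.I) * (1 + Complex.I) = (1 - Complex.I) + (1 + Complex.I) := by
  apply Complex.ext <;> norm_num

/-- The unitary matrix `1 - (1 - i) P`, where `P` is the orthogonal projection onto the indicator
vector of `s`. It is the identity off `s`, and all its entries with both indices in `s` are
nonzero. -/
def mixUnitary {n : ℕ} (s : Finset (Fin n)) : Matrix.unitaryGroup (Fin n) ℂ :=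
  ⟨mixMatrix s (1 - Complex.I), by
    have h : (mixMatrix s (1 - Complex.I)).conjTranspose = mixMatrix s (1 + Complex.I) := by
      rw [mixMatrix, mixMatrix, Matrix.conjTranspose_sub, Matrix.conjTranspose_smul,
        avgMatrix_conjTranspose, Matrix.conjTranspose_one]
      simp
    rw [Matrix.mem_unitaryGroup_iff, Matrix.star_eq_conjTranspose, h]
    exact mixMatrix_mul_mixMatrix s one_sub_I_mul⟩

theorem mixMatrix_apply_of_mem {n : ℕ} {s : Finset (Fin n)} (c : ℂ) {p : Fin n} (hp : p ∈ s)
    (z : Cn n) : Matrix.toEuclideanCLM (𝕜 := ℂ) (mixMatrix s c) z p =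
      ∑ q ∈ s, ((if p = q then 1 else 0) - c * (s.card : ℂ)⁻¹) * z q := by
  rw [Matrix.ofLp_toEuclideanCLM, mixMatrix, Matrix.sub_mulVec, Matrix.one_mulVec]
  simp [sub_mul, Finset.sum_sub_distrib, hp, Matrix.mulVec, dotProduct, avgMatrix, mul_assoc]

theorem mixMatrix_apply_of_notMem {n : ℕ} {s : Finset (Fin n)} (c : ℂ) {p : Fin n} (hp : p ∉ s)
    (z : Cn n) : Matrix.toEuclideanCLM (𝕜 := ℂ) (mixMatrix s c) z p = z p := by
  rw [Matrix.ofLp_toEuclideanCLM, mixMatrix, Matrix.sub_mulVec, Matrix.one_mulVec]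
  simp [hp, Matrix.mulVec, dotProduct, avgMatrix]

theorem prod_compl_mixMatrix {n : ℕ} (s : Finset (Fin n)) (c : ℂ) (w : Fin n → ℕ) (z : Cn n) :
    ∏ p ∈ sᶜ, Matrix.toEuclideanCLM (𝕜 := ℂ) (mixMatrix s c) z p ^ w p = ∏ p ∈ sᶜ, z p ^ w p :=
  Finset.prod_congr rfl fun p hp => by rw [mixMatrix_apply_of_notMem _ (Finset.mem_compl.1 hp)]

theorem mix_coeff_ne_zero (k : ℕ) (hk : k ≠ 0) (p : Prop) [Decidable p] :
    ((if p then 1 else 0) - (1 - Complex.I) * (k : ℂ)⁻¹ : ℂ) ≠ 0 := by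
  intro h
  have h1 := congrArg Complex.im h
  have hk' : (k : ℝ) ≠ 0 := by exact_mod_cast hk
  split_ifs at h1 <;> simp [← Complex.ofReal_natCast, ← Complex.ofReal_inv] at h1 <;> exact hk h1

theorem mon_piecewise {n : ℕ} (s : Finset (Fin n)) (κ u : Fin n → ℕ) (z : Cn n) :
    mon (s.piecewise κ u) z = (∏ p ∈ s, z p ^ κ p) * ∏ p ∈ sᶜ, z p ^ u p := by
  rw [mon, ← Finset.prod_mul_prod_compl s]
  congr 1
  · exact Finset.prod_congr rfl fun p hp => by simp [hp]
  · exact Finset.prod_congr rfl fun p hp => by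
      rw [Finset.piecewise_eq_of_notMem _ _ _ (Finset.mem_compl.1 hp)]

/-- Polynomial functions in the coordinates `z p`, `p ∈ s`. -/
def blockPolynomials {n : ℕ} (s : Finset (Fin n)) : Subalgebra ℂ (Cn n → ℂ) :=
  Submodule.toSubalgebra
    (Submodule.span ℂ (Set.range fun (k : Fin n → ℕ) (z : Cn n) => ∏ p ∈ s, z p ^ k p))
    (Submodule.subset_span ⟨0, by ext; simp⟩) fun f g hf hg => by
      have h := Submodule.mul_mem_mul hf hg
      rw [Submodule.span_mul_span] at h
      refine Submodule.span_mono ?_ h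
      rintro _ ⟨_, ⟨k, rfl⟩, _, ⟨l, rfl⟩, rfl⟩
      exact ⟨k + l, by ext z; simp [pow_add, Finset.prod_mul_distrib]⟩

theorem coord_mem_blockPolynomials {n : ℕ} {s : Finset (Fin n)} {q : Fin n} (hq : q ∈ s) :
    (fun z : Cn n => z q) ∈ blockPolynomials s := by
  refine Submodule.subset_span ⟨Pi.single q 1, ?_⟩
  ext z
  change ∏ p ∈ s, z p ^ (Pi.single q 1 : Fin n → ℕ) p = z q
  rw [Finset.prod_eq_single q]
  · simp
  · intro p _ hp
    simp [hp]
  · exact fun h => absurd hq h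

/-- The monomials in the coordinates of the block `s`, pulled back by a matrix acting on this block,
are again polynomials in these coordinates. -/
theorem prod_mixMatrix_mem {n : ℕ} (s : Finset (Fin n)) (c : ℂ) (κ : Fin n → ℕ) :
    (fun z : Cn n => ∏ p ∈ s, Matrix.toEuclideanCLM (𝕜 := ℂ) (mixMatrix s c) z p ^ κ p) ∈
      blockPolynomials s := by
  have : (fun z : Cn n => ∏ p ∈ s,
        Matrix.toEuclideanCLM (𝕜 := ℂ) (mixMatrix s c) z p ^ κ p) =
      ∏ p ∈ s, (∑ q ∈ s, ((if p = q then 1 else 0) - c * (s.card : ℂ)⁻¹) •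
        (fun z : Cn n => z q)) ^ κ p := by
    ext z
    simp only [Finset.prod_apply, Pi.pow_apply, Finset.sum_apply, Pi.smul_apply, smul_eq_mul]
    exact Finset.prod_congr rfl fun p hp => by rw [mixMatrix_apply_of_mem c hp]
  rw [this]
  exact prod_mem fun p _ => pow_mem (sum_mem fun q hq =>
    Subalgebra.smul_mem _ (coord_mem_blockPolynomials hq) _) _

theorem symbolForm_mixUnitary {n : ℕ} {lam : ℝ} {s : Finset (Fin n)} {a : Cn n → ℂ}
    (ha : InvariantUnder lam (mixUnitary s) a) (p q : Cn n → ℂ) :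
    symbolForm lam a p
      (fun z => q (Matrix.toEuclideanCLM (𝕜 := ℂ) (mixMatrix s (1 - Complex.I)) z)) =
    symbolForm lam a
      (fun z => p (Matrix.toEuclideanCLM (𝕜 := ℂ) (mixMatrix s (1 + Complex.I)) z)) q := by
  rw [← symbolForm_comp ha _ q]
  congr 1
  ext z
  have h := congrArg (Matrix.toEuclideanCLM (𝕜 := ℂ)) (mixMatrix_mul_mixMatrix s
    (c := 1 + Complex.I) (d := 1 - Complex.I) (by rw [mul_comm, one_sub_I_mul, add_comm]))
  rw [map_mul, map_one] at h
  exact congrArg p (DFunLike.congr_fun h z).symm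

/-- A power of one coordinate in the block, pulled back by `mixUnitary`, contains all monomials of
the same degree in the block with a nonzero coefficient. -/
theorem exists_mon_single_mix_expansion {n : ℕ} {s : Finset (Fin n)} {p : Fin n} (hp : p ∈ s)
    (d : ℕ) : ∃ C : (Fin n → ℕ) → ℂ, (∀ k, C k ≠ 0) ∧ ∀ (w : Fin n → ℕ) (z : Cn n),
      mon (s.piecewise (Pi.single p d) w)
        (Matrix.toEuclideanCLM (𝕜 := ℂ) (mixMatrix s (1 - Complex.I)) z) =
      ∑ k ∈ s.piAntidiag d, C k * mon (s.piecewise k w) z := by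
  refine ⟨fun k => Nat.multinomial s k *
    ∏ q ∈ s, ((if p = q then 1 else 0) - (1 - Complex.I) * (s.card : ℂ)⁻¹) ^ k q,
    fun k => mul_ne_zero (Nat.cast_ne_zero.2 (Nat.multinomial_pos _ _).ne')
      (Finset.prod_ne_zero_iff.2 fun q _ => pow_ne_zero _
        (mix_coeff_ne_zero _ (Finset.card_ne_zero_of_mem hp) _)), fun w z => ?_⟩
  rw [mon_piecewise, Finset.prod_eq_single_of_mem p hp (fun q _ hq => by simp [hq]),
    Pi.single_eq_same, mixMatrix_apply_of_mem _ hp, Finset.sum_pow_eq_sum_piAntidiag,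
    Finset.sum_mul]
  refine Finset.sum_congr rfl fun k _ => ?_
  rw [mon_piecewise]
  simp only [mul_pow, Finset.prod_mul_distrib, prod_compl_mixMatrix]
  ring

theorem exists_mon_mix_expansion {n : ℕ} (s : Finset (Fin n)) (c : ℂ) (κ : Fin n → ℕ) :
    ∃ D : (Fin n → ℕ) →₀ ℂ, ∀ (u : Fin n → ℕ) (z : Cn n),
      mon (s.piecewise κ u) (Matrix.toEuclideanCLM (𝕜 := ℂ) (mixMatrix s c) z) =
      ∑ k ∈ D.support, D k * mon (s.piecewise k u) z := by
  obtain ⟨D, hD⟩ := Finsupp.mem_span_range_iff_exists_finsupp.1 (prod_mixMatrix_mem s c κ)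
  refine ⟨D, fun u z => ?_⟩
  have h := congrFun hD z
  rw [mon_piecewise, ← h, Finsupp.sum, Finset.sum_apply, Finset.sum_mul]
  refine Finset.sum_congr rfl fun k _ => ?_
  rw [mon_piecewise, prod_compl_mixMatrix]
  simp only [Pi.smul_apply, smul_eq_mul]
  ring

/-- Essentially bounded symbols that are invariant under the rotations of each single coordinate in
`s` and under `mixUnitary s`. These are the invariances under the unitary group of the block `s`
that the argument needs. -/
structure BlockInvariant {n : ℕ} (lam : ℝ) (s : Finset (Fin n)) (a : Cn n → ℂ) : Prop where
  memLp : MemLp a ∞ (bergmanMeasure n lam)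
  rotation : ∀ p ∈ s, ∀ c, InvariantUnder lam (blockScalar {p} c) a
  mix : InvariantUnder lam (mixUnitary s) a

theorem BlockInvariant.symbolForm_eq_zero {n : ℕ} {lam : ℝ} {s : Finset (Fin n)} {a : Cn n → ℂ}
    (ha : BlockInvariant lam s a) {α β : Fin n → ℕ} {p : Fin n} (hp : p ∈ s) (h : α p ≠ β p) :
    symbolForm lam a (mon α) (mon β) = 0 :=
  symbolForm_mon_eq_zero (ha.rotation p hp) (by simpa using h)

/-- The dependence of the form on the exponents in the block `s` is a factor that does not depend
on the symbol, nor on the exponents off the block. Here the exponents in the block are compared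
with those of a pure power of one coordinate. -/
theorem exists_symbolForm_eq_single {n : ℕ} (hn : n ≠ 0) {lam : ℝ} (hlam : -1 < lam)
    {s : Finset (Fin n)} {p : Fin n} (hp : p ∈ s) (κ : Fin n → ℕ) :
    ∃ R : ℂ, ∀ a, BlockInvariant lam s a → ∀ u w : Fin n → ℕ,
      symbolForm lam a (mon (s.piecewise κ u)) (mon (s.piecewise κ w)) =
        R * symbolForm lam a (mon (s.piecewise (Pi.single p (∑ q ∈ s, κ q)) u))
          (mon (s.piecewise (Pi.single p (∑ q ∈ s, κ q)) w)) := by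
  set d := ∑ q ∈ s, κ q with hd
  obtain ⟨C, hC, hCe⟩ := exists_mon_single_mix_expansion hp d
  obtain ⟨D, hD⟩ := exists_mon_mix_expansion s (1 + Complex.I) κ
  classical
  refine ⟨(C (s.piecewise κ 0))⁻¹ * ∑ k ∈ D.support, if ∀ q ∈ s, k q = (Pi.single p d : Fin n → ℕ) q then
    conj (D k) else 0, fun a ha u w => ?_⟩
  have h := symbolForm_mixUnitary ha.mix (mon (s.piecewise κ u))
    (mon (s.piecewise (Pi.single p d) w))
  simp only [hCe, hD] at h
  rw [symbolForm_sum_right hn hlam _ _ ha.memLp (continuous_mon _) (fun _ => continuous_mon _),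
    symbolForm_sum_left hn hlam _ _ ha.memLp (fun _ => continuous_mon _) (continuous_mon _)] at h
  -- on the left only the exponents that agree with `κ` on `s` survive
  have hl : ∑ k ∈ s.piAntidiag d, C k *
      symbolForm lam a (mon (s.piecewise κ u)) (mon (s.piecewise k w)) =
      C (s.piecewise κ 0) * symbolForm lam a (mon (s.piecewise κ u)) (mon (s.piecewise κ w)) := by
    rw [Finset.sum_eq_single (s.piecewise κ 0)]
    · rw [Finset.piecewise_piecewise_of_subset_left subset_rfl]
    · intro k hk hne
      rw [Finset.mem_piAntidiag] at hk
      obtain ⟨q, hq⟩ := Function.ne_iff.1 hne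
      by_cases hqs : q ∈ s
      · rw [ha.symbolForm_eq_zero hqs (by simpa [hqs] using (Ne.symm hq)), mul_zero]
      · refine absurd ?_ hq
        simpa [hqs] using mt (hk.2 q) hqs
    · intro hk
      refine absurd ?_ hk
      rw [Finset.mem_piAntidiag]
      refine ⟨by rw [hd]; exact Finset.sum_congr rfl fun q hq => by simp [hq], fun q hq => ?_⟩
      by_contra hqs
      simp [hqs] at hq
  have hr : ∀ k ∈ D.support, conj (D k) * symbolForm lam a (mon (s.piecewise k u))
        (mon (s.piecewise (Pi.single p d) w)) =
      (if ∀ q ∈ s, k q = (Pi.single p d : Fin n → ℕ) q then conj (D k) else 0) *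
        symbolForm lam a (mon (s.piecewise (Pi.single p d) u))
          (mon (s.piecewise (Pi.single p d) w)) := by
    intro k _
    split_ifs with hk
    · rw [s.piecewise_congr hk fun _ _ => rfl]
    · push Not at hk
      obtain ⟨q, hq, hkq⟩ := hk
      rw [ha.symbolForm_eq_zero hq (by simpa [hq] using hkq), mul_zero, zero_mul]
  rw [hl, Finset.sum_congr rfl hr, ← Finset.sum_mul] at h
  rw [mul_assoc, ← h, inv_mul_cancel_left₀ (hC _)]

theorem blockInvariant_one {n : ℕ} (hn : n ≠ 0) {lam : ℝ} (hlam : -1 < lam)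
    (s : Finset (Fin n)) : BlockInvariant lam s (1 : Cn n → ℂ) where
  memLp := by
    have := isFiniteMeasure_bergmanMeasure hn hlam
    exact memLp_const 1
  rotation _ _ _ := invariantUnder_one lam _
  mix := invariantUnder_one lam _

/-- The dependence of the form on the exponents in the block `s`, for a fixed total degree in this
block, is a nonzero factor that does not depend on the symbol, nor on the exponents off the
block. -/
theorem exists_symbolForm_eq {n : ℕ} (hn : n ≠ 0) {lam : ℝ} (hlam : -1 < lam)
    {s : Finset (Fin n)} (hs : s.Nonempty) {κ δ : Fin n → ℕ}
    (h : ∑ q ∈ s, κ q = ∑ q ∈ s, δ q) :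
    ∃ R : ℂ, R ≠ 0 ∧ ∀ a, BlockInvariant lam s a → ∀ u w : Fin n → ℕ,
      symbolForm lam a (mon (s.piecewise κ u)) (mon (s.piecewise κ w)) =
        R * symbolForm lam a (mon (s.piecewise δ u)) (mon (s.piecewise δ w)) := by
  obtain ⟨p, hp⟩ := hs
  obtain ⟨R, hR⟩ := exists_symbolForm_eq_single hn hlam hp κ
  obtain ⟨S, hS⟩ := exists_symbolForm_eq_single hn hlam hp δ
  have h1 := blockInvariant_one hn hlam s
  have hR0 : R ≠ 0 := by
    rintro rfl
    have := hR 1 h1 0 0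
    rw [zero_mul] at this
    exact symbolForm_one_mon_self_ne_zero hn hlam _ this
  have hS0 : S ≠ 0 := by
    rintro rfl
    have := hS 1 h1 0 0
    rw [zero_mul] at this
    exact symbolForm_one_mon_self_ne_zero hn hlam _ this
  refine ⟨R * S⁻¹, mul_ne_zero hR0 (inv_ne_zero hS0), fun a ha u w => ?_⟩
  rw [hR a ha, hS a ha, h, mul_assoc, inv_mul_cancel_left₀ hS0]

/-! ### Taylor coefficients on the unit disc -/

/-- The `d`-th Taylor coefficient of a holomorphic function on the closed unit disc, as a Fourier
coefficient of its restriction to the circle. -/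
def discCoeff (d : ℕ) (h : ℂ → ℂ) : ℂ :=
  (2 * Real.pi : ℂ)⁻¹ *
    ∫ θ in Set.Ioc 0 (2 * Real.pi), ((Circle.exp θ : ℂ)⁻¹) ^ d * h (Circle.exp θ)

theorem cauchyPowerSeries_coeff_eq_discCoeff (d : ℕ) (h : ℂ → ℂ) :
    (cauchyPowerSeries h 0 1).coeff d = discCoeff d h := by
  have h1 : (cauchyPowerSeries h 0 1).coeff d = cauchyPowerSeries h 0 1 d fun _ => 1 := rfl
  rw [h1, cauchyPowerSeries_apply, circleIntegral,
    intervalIntegral.integral_of_le (by positivity), discCoeff, smul_eq_mul,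
    ← integral_const_mul, ← integral_const_mul]
  refine integral_congr_ae (Eventually.of_forall fun θ => ?_)
  have h2 : circleMap 0 1 θ = Circle.exp θ := by simp [circleMap]
  have h3 : (Circle.exp θ : ℂ) ≠ 0 := Circle.coe_ne_zero _
  simp only [deriv_circleMap, sub_zero, smul_eq_mul, h2, one_div]
  have := Complex.I_ne_zero
  field_simp

theorem hasFPowerSeriesAt_cauchyPowerSeries {h : ℂ → ℂ}
    (hh : DifferentiableOn ℂ h (closedBall 0 1)) :
    HasFPowerSeriesOnBall h (cauchyPowerSeries h 0 1) 0 1 := by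
  have := DifferentiableOn.hasFPowerSeriesOnBall (R := 1) (by simpa using hh) one_pos
  simpa using this

theorem discCoeff_comp_mul {h : ℂ → ℂ} (hh : DifferentiableOn ℂ h (closedBall 0 1)) {ζ : ℂ}
    (hζ : ‖ζ‖ ≤ 1) (d : ℕ) : discCoeff d (fun w => h (w * ζ)) = ζ ^ d * discCoeff d h := by
  have h1 : DifferentiableOn ℂ (fun w => h (w * ζ)) (closedBall 0 1) := by
    refine hh.comp (by fun_prop) fun w hw => ?_
    simp only [mem_closedBall, dist_zero_right] at hw ⊢
    rw [norm_mul]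
    exact mul_le_one₀ hw (norm_nonneg _) hζ
  have p1 := (hasFPowerSeriesAt_cauchyPowerSeries h1).hasFPowerSeriesAt
  set u : ℂ →L[ℂ] ℂ := ζ • ContinuousLinearMap.id ℂ ℂ with hu
  have p2 := (HasFPowerSeriesAt.compContinuousLinearMap (u := u) (x := (0 : ℂ)) (f := h)
    (pf := cauchyPowerSeries h 0 1)
    (by simpa using (hasFPowerSeriesAt_cauchyPowerSeries hh).hasFPowerSeriesAt))
  have hcomp : h ∘ u = fun w => h (w * ζ) := by
    ext w
    simp [hu, mul_comm]
  rw [hcomp] at p2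
  rw [← cauchyPowerSeries_coeff_eq_discCoeff, ← cauchyPowerSeries_coeff_eq_discCoeff,
    p1.eq_formalMultilinearSeries p2, FormalMultilinearSeries.coeff,
    FormalMultilinearSeries.compContinuousLinearMap_apply]
  have : (u ∘ (1 : Fin d → ℂ)) = fun _ => ζ := by
    ext
    simp [hu]
  rw [this, FormalMultilinearSeries.apply_eq_pow_smul_coeff, smul_eq_mul]

theorem exists_discCoeff_ne_zero {h : ℂ → ℂ} (hh : DifferentiableOn ℂ h (closedBall 0 1))
    (h1 : h 1 ≠ 0) : ∃ d, discCoeff d h ≠ 0 := by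
  by_contra! hd
  have hz : Set.EqOn h 0 (ball 0 1) := by
    intro w hw
    have hs := (hasFPowerSeriesAt_cauchyPowerSeries hh).hasSum (y := w) (by
      rw [mem_ball_zero_iff] at hw
      simpa [← ofReal_norm] using hw)
    simp only [FormalMultilinearSeries.apply_eq_pow_smul_coeff,
      cauchyPowerSeries_coeff_eq_discCoeff, hd, smul_zero, zero_add] at hs
    exact hs.unique hasSum_zero
  have hz' := hz.of_subset_closure hh.continuousOn continuousOn_const ball_subset_closedBall
    (closure_ball (0 : ℂ) one_ne_zero).ge
  exact h1 (hz' (by simp))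

/-! ### Homogeneous components in one coordinate -/

/-- Multiplication of the `i`-th coordinate by `ζ`. -/
def rot {n : ℕ} (i : Fin n) (ζ : ℂ) : Cn n →L[ℂ] Cn n :=
  ContinuousLinearMap.id ℂ _ +
    (ζ - 1) • (EuclideanSpace.proj i : Cn n →L[ℂ] ℂ).smulRight (EuclideanSpace.single i 1)

theorem rot_apply {n : ℕ} (i : Fin n) (ζ : ℂ) (z : Cn n) (j : Fin n) :
    rot i ζ z j = if j = i then ζ * z j else z j := by
  by_cases h : j = i
  · subst h
    simp [rot]
    ring
  · simp [rot, h]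

theorem continuous_rot {n : ℕ} (i : Fin n) : Continuous (rot i) := by
  unfold rot
  fun_prop

theorem rot_one {n : ℕ} (i : Fin n) (z : Cn n) : rot i 1 z = z := by
  simp [rot]

theorem rot_rot_same {n : ℕ} (i : Fin n) (ζ w : ℂ) (z : Cn n) :
    rot i w (rot i ζ z) = rot i (w * ζ) z := by
  ext j
  by_cases h : j = i <;> simp [rot_apply, h, mul_assoc]

theorem rot_comm {n : ℕ} (i j : Fin n) (ζ w : ℂ) (z : Cn n) :
    rot i w (rot j ζ z) = rot j ζ (rot i w z) := by
  ext k
  by_cases h : k = i <;> by_cases h' : k = j <;> simp [rot_apply, h, h', mul_left_comm]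

theorem norm_rot_le {n : ℕ} (i : Fin n) {ζ : ℂ} (hζ : ‖ζ‖ ≤ 1) (z : Cn n) :
    ‖rot i ζ z‖ ≤ ‖z‖ := by
  rw [EuclideanSpace.norm_eq, EuclideanSpace.norm_eq]
  refine Real.sqrt_le_sqrt (Finset.sum_le_sum fun j _ => ?_)
  rw [rot_apply]
  split_ifs
  · rw [norm_mul]
    gcongr
    exact mul_le_of_le_one_left (norm_nonneg _) hζ
  · rfl

theorem rot_mem_unitBall {n : ℕ} (i : Fin n) {ζ : ℂ} (hζ : ‖ζ‖ ≤ 1) {z : Cn n}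
    (hz : z ∈ unitBall n) : rot i ζ z ∈ unitBall n := by
  rw [mem_unitBall] at hz ⊢
  exact (norm_rot_le i hζ z).trans_lt hz

theorem measurePreserving_rot {n : ℕ} (lam : ℝ) (i : Fin n) (t : Circle) :
    MeasurePreserving (rot i t : Cn n → Cn n) (bergmanMeasure n lam) (bergmanMeasure n lam) ∧
      MeasurableEmbedding (rot i t : Cn n → Cn n) := by
  obtain ⟨L, hL⟩ := exists_linearIsometryEquiv (blockScalar {i} t)
  have : (rot i t : Cn n → Cn n) = L := by
    ext z j
    rw [hL, blockScalar, diagUnitary_apply, rot_apply]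
    by_cases h : j = i <;> simp [h]
  rw [this]
  exact ⟨measurePreserving_linearIsometryEquiv lam L, L.toHomeomorph.measurableEmbedding⟩

theorem mon_rot {n : ℕ} (i : Fin n) (ζ : ℂ) (α : Fin n → ℕ) (z : Cn n) :
    mon α (rot i ζ z) = ζ ^ α i * mon α z := by
  unfold mon
  rw [← Finset.mul_prod_erase _ _ (Finset.mem_univ i),
    ← Finset.mul_prod_erase _ (fun j => z j ^ α j) (Finset.mem_univ i), ← mul_assoc]
  congr 1
  · simp [rot_apply, mul_pow]
  · refine Finset.prod_congr rfl fun j hj => ?_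
    simp [rot_apply, Finset.ne_of_mem_erase hj]

/-- The component of `f` that is homogeneous of degree `d` in the `i`-th coordinate. -/
def coordComponent {n : ℕ} (i : Fin n) (d : ℕ) (f : Cn n → ℂ) (z : Cn n) : ℂ :=
  discCoeff d fun ζ => f (rot i ζ z)

theorem differentiableOn_slice {n : ℕ} (i : Fin n) {f : Cn n → ℂ}
    (hf : DifferentiableOn ℂ f (unitBall n)) {z : Cn n} (hz : z ∈ unitBall n) :
    DifferentiableOn ℂ (fun ζ => f (rot i ζ z)) (closedBall 0 1) := by
  refine hf.comp (Differentiable.differentiableOn ?_) fun ζ hζ => rot_mem_unitBall i ?_ hz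
  · simp only [rot, _root_.add_apply, _root_.smul_apply]
    fun_prop
  · simpa using hζ

theorem coordComponent_rot_self {n : ℕ} (i : Fin n) (d : ℕ) {f : Cn n → ℂ}
    (hf : DifferentiableOn ℂ f (unitBall n)) {z : Cn n} (hz : z ∈ unitBall n) {ζ : ℂ}
    (hζ : ‖ζ‖ ≤ 1) : coordComponent i d f (rot i ζ z) = ζ ^ d * coordComponent i d f z := by
  unfold coordComponent
  rw [← discCoeff_comp_mul (differentiableOn_slice i hf hz) hζ]
  simp only [rot_rot_same]

theorem exists_coordComponent_ne_zero {n : ℕ} (i : Fin n) {f : Cn n → ℂ}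
    (hf : DifferentiableOn ℂ f (unitBall n)) {z : Cn n} (hz : z ∈ unitBall n) (h : f z ≠ 0) :
    ∃ d, coordComponent i d f z ≠ 0 :=
  exists_discCoeff_ne_zero (differentiableOn_slice i hf hz) (by rwa [rot_one])

theorem discCoeff_const_mul (d : ℕ) (c : ℂ) (h : ℂ → ℂ) :
    discCoeff d (fun w => c * h w) = c * discCoeff d h := by
  unfold discCoeff
  simp only [mul_left_comm _ c, integral_const_mul]

theorem discCoeff_congr (d : ℕ) {h g : ℂ → ℂ} (hg : ∀ t : Circle, h t = g t) :
    discCoeff d h = discCoeff d g := by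
  unfold discCoeff
  simp only [hg]

theorem coordComponent_rot_of_homogeneous {n : ℕ} (i j : Fin n) (d e : ℕ) {f : Cn n → ℂ} {ζ : ℂ}
    (hf : ∀ z ∈ unitBall n, f (rot j ζ z) = ζ ^ e * f z) {z : Cn n} (hz : z ∈ unitBall n) :
    coordComponent i d f (rot j ζ z) = ζ ^ e * coordComponent i d f z := by
  unfold coordComponent
  rw [← discCoeff_const_mul]
  refine discCoeff_congr d fun t => ?_
  rw [rot_comm, hf _ (rot_mem_unitBall i (Circle.norm_coe _).le hz)]

/-- Cauchy estimates: the derivative of a holomorphic function is bounded on smaller balls. -/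
theorem exists_norm_fderiv_le {n : ℕ} {f : Cn n → ℂ} (hf : DifferentiableOn ℂ f (unitBall n))
    {ρ : ℝ} (hρ : ρ < 1) : ∃ K, ∀ w : Cn n, ‖w‖ ≤ ρ → ‖fderiv ℂ f w‖ ≤ K := by
  set ε : ℝ := (1 - ρ) / 2 with hε
  have hε0 : 0 < ε := by rw [hε]; linarith
  have hsub : closedBall (0 : Cn n) (ρ + ε) ⊆ unitBall n :=
    closedBall_subset_ball (by rw [hε]; linarith)
  obtain ⟨M, hM⟩ := (isCompact_closedBall (0 : Cn n) (ρ + ε)).exists_bound_of_continuousOn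
    (hf.continuousOn.mono hsub)
  refine ⟨(M + M) / ε, fun w hw => ?_⟩
  have hb : ball w ε ⊆ closedBall (0 : Cn n) (ρ + ε) := by
    intro v hv
    rw [mem_ball_iff_norm] at hv
    rw [mem_closedBall_zero_iff]
    calc ‖v‖ = ‖w + (v - w)‖ := by rw [add_sub_cancel]
      _ ≤ ‖w‖ + ‖v - w‖ := norm_add_le _ _
      _ ≤ ρ + ε := by linarith
  refine Complex.norm_fderiv_le_div_of_mapsTo_ball (hf.mono (hb.trans hsub)) (fun v hv => ?_) hε0
  rw [mem_closedBall_iff_norm]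
  exact (norm_sub_le _ _).trans (add_le_add (hM v (hb hv)) (hM w (hb (mem_ball_self hε0))))

/-- Homogeneous components are holomorphic, by differentiation under the integral sign; the Cauchy
estimates provide the dominating constant. -/
theorem differentiableOn_coordComponent {n : ℕ} (i : Fin n) (d : ℕ) {f : Cn n → ℂ}
    (hf : DifferentiableOn ℂ f (unitBall n)) :
    DifferentiableOn ℂ (coordComponent i d f) (unitBall n) := by
  intro z₀ hz₀
  have hz1 : ‖z₀‖ < 1 := mem_unitBall.1 hz₀
  set r : ℝ := (1 - ‖z₀‖) / 2 with hr
  have hr0 : 0 < r := by rw [hr]; linarith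
  have hρ : ‖z₀‖ + r < 1 := by rw [hr]; linarith
  obtain ⟨K, hK⟩ := exists_norm_fderiv_le hf hρ
  have hs : ∀ z ∈ ball z₀ r, ‖z‖ ≤ ‖z₀‖ + r := by
    intro z hz
    rw [mem_ball_iff_norm] at hz
    calc ‖z‖ = ‖z₀ + (z - z₀)‖ := by rw [add_sub_cancel]
      _ ≤ ‖z₀‖ + ‖z - z₀‖ := norm_add_le _ _
      _ ≤ _ := by linarith
  have hsb : ∀ z ∈ ball z₀ r, z ∈ unitBall n := fun z hz =>
    mem_unitBall.2 ((hs z hz).trans_lt hρ)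
  have hcirc : Continuous fun θ : ℝ => (Circle.exp θ : ℂ) := by fun_prop
  have hcinv : Continuous fun θ : ℝ => ((Circle.exp θ : ℂ)⁻¹) ^ d :=
    (hcirc.inv₀ fun θ => Circle.coe_ne_zero _).pow d
  have hrot : ∀ z : Cn n, Continuous fun θ : ℝ => rot i (Circle.exp θ) z := fun z =>
    ((continuous_rot i).comp hcirc).clm_apply continuous_const
  have hFc : ∀ z ∈ unitBall n, Continuous fun θ : ℝ =>
      ((Circle.exp θ : ℂ)⁻¹) ^ d * f (rot i (Circle.exp θ) z) := fun z hz =>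
    hcinv.mul (hf.continuousOn.comp_continuous (hrot z)
      fun θ => rot_mem_unitBall i (Circle.norm_coe _).le hz)
  have hmeas : AEStronglyMeasurable (fun θ : ℝ => ((Circle.exp θ : ℂ)⁻¹) ^ d •
      (fderiv ℂ f (rot i (Circle.exp θ) z₀)).comp (rot i (Circle.exp θ)))
      (volume.restrict (Set.Ioc 0 (2 * Real.pi))) := by
    have h1 : Measurable (fun θ : ℝ => fderiv ℂ f (rot i (Circle.exp θ) z₀)) :=
      (measurable_fderiv ℂ f).comp (hrot z₀).measurable
    have h2 : Continuous (fun θ : ℝ => rot (n := n) i (Circle.exp θ)) :=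
      (continuous_rot i).comp hcirc
    have h3 : Continuous fun x : (Cn n →L[ℂ] ℂ) × (Cn n →L[ℂ] Cn n) => x.1.comp x.2 := by
      fun_prop
    exact hcinv.aestronglyMeasurable.smul
      (h3.comp_aestronglyMeasurable (h1.aestronglyMeasurable.prodMk h2.aestronglyMeasurable))
  have hbound : ∀ (θ : ℝ), ∀ z ∈ ball z₀ r, ‖((Circle.exp θ : ℂ)⁻¹) ^ d •
      (fderiv ℂ f (rot i (Circle.exp θ) z)).comp (rot i (Circle.exp θ))‖ ≤ K := by
    intro θ z hz
    have h1 : ‖rot (n := n) i (Circle.exp θ)‖ ≤ 1 :=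
      ContinuousLinearMap.opNorm_le_bound _ zero_le_one fun w => by
        rw [one_mul]
        exact norm_rot_le i (Circle.norm_coe _).le w
    have h2 := hK (rot i (Circle.exp θ) z)
      ((norm_rot_le i (Circle.norm_coe _).le z).trans (hs z hz))
    rw [norm_smul, norm_pow, norm_inv, Circle.norm_coe, inv_one, one_pow, one_mul]
    calc _ ≤ _ := ContinuousLinearMap.opNorm_comp_le _ _
      _ ≤ K * 1 := mul_le_mul h2 h1 (norm_nonneg _) ((norm_nonneg _).trans h2)
      _ = K := mul_one K
  have hderiv : ∀ (θ : ℝ), ∀ z ∈ ball z₀ r,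
      HasFDerivAt (fun z => ((Circle.exp θ : ℂ)⁻¹) ^ d * f (rot i (Circle.exp θ) z))
        (((Circle.exp θ : ℂ)⁻¹) ^ d •
          (fderiv ℂ f (rot i (Circle.exp θ) z)).comp (rot i (Circle.exp θ))) z := by
    intro θ z hz
    have h1 : HasFDerivAt f (fderiv ℂ f (rot i (Circle.exp θ) z)) (rot i (Circle.exp θ) z) :=
      (hf.differentiableAt (isOpen_ball.mem_nhds
        (rot_mem_unitBall i (Circle.norm_coe _).le (hsb z hz)))).hasFDerivAt
    exact (h1.comp z (rot i (Circle.exp θ)).hasFDerivAt).const_mul _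
  have key := hasFDerivAt_integral_of_dominated_of_fderiv_le (𝕜 := ℂ)
    (μ := volume.restrict (Set.Ioc 0 (2 * Real.pi)))
    (F := fun z θ => ((Circle.exp θ : ℂ)⁻¹) ^ d * f (rot i (Circle.exp θ) z))
    (F' := fun z θ => ((Circle.exp θ : ℂ)⁻¹) ^ d •
      (fderiv ℂ f (rot i (Circle.exp θ) z)).comp (rot i (Circle.exp θ)))
    (bound := fun _ => K) (ball_mem_nhds z₀ hr0)
    (by
      filter_upwards [ball_mem_nhds z₀ hr0] with z hz
      exact (hFc z (hsb z hz)).aestronglyMeasurable)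
    ((hFc z₀ hz₀).integrableOn_Ioc) hmeas (Eventually.of_forall hbound)
    (integrable_const K) (Eventually.of_forall hderiv)
  exact (key.differentiableAt.const_mul _).differentiableWithinAt

theorem integral_rot {n : ℕ} {lam : ℝ} (i : Fin n) (t : Circle) {E : Type*}
    [NormedAddCommGroup E] [NormedSpace ℝ E] (F : Cn n → E) :
    ∫ z, F (rot i t z) ∂(bergmanMeasure n lam) = ∫ z, F z ∂(bergmanMeasure n lam) :=
  (measurePreserving_rot lam i t).1.integral_comp (measurePreserving_rot lam i t).2 F

theorem integrable_rot {n : ℕ} {lam : ℝ} (i : Fin n) (t : Circle) {F : Cn n → ℂ}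
    (hF : Integrable F (bergmanMeasure n lam)) :
    Integrable (fun z => F (rot i t z)) (bergmanMeasure n lam) :=
  (MeasurePreserving.integrable_comp_emb (g := F) (measurePreserving_rot lam i t).1
    (measurePreserving_rot lam i t).2).2 hF

theorem integrable_prod_family {n : ℕ} {lam : ℝ} [IsFiniteMeasure (bergmanMeasure n lam)]
    {ν : Measure ℝ} [IsFiniteMeasure ν] {k e : ℝ → ℂ} (hk : Continuous k) (hk1 : ∀ θ, ‖k θ‖ = 1)
    (he : Continuous e) (i : Fin n) {F : Cn n → ℂ} (hm : Measurable F)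
    (hint : ∀ θ, Integrable (fun z => F (rot i (e θ) z)) (bergmanMeasure n lam))
    (hnorm : ∀ θ, ∫ z, ‖F (rot i (e θ) z)‖ ∂(bergmanMeasure n lam) =
      ∫ z, ‖F z‖ ∂(bergmanMeasure n lam)) :
    Integrable (fun x : Cn n × ℝ => k x.2 * F (rot i (e x.2) x.1))
      ((bergmanMeasure n lam).prod ν) := by
  have hrot : Continuous fun x : Cn n × ℝ => rot i (e x.2) x.1 :=
    ((continuous_rot i).comp (he.comp continuous_snd)).clm_apply continuous_fst
  have hmeas : Measurable (fun x : Cn n × ℝ => k x.2 * F (rot i (e x.2) x.1)) :=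
    (hk.comp continuous_snd).measurable.mul (hm.comp hrot.measurable)
  rw [integrable_prod_iff' hmeas.aestronglyMeasurable]
  refine ⟨Eventually.of_forall fun θ => ?_, ?_⟩
  · dsimp only
    exact (hint θ).const_mul (k θ)
  simp only [norm_mul, hk1, one_mul, hnorm]
  exact integrable_const _

theorem integrable_prod_rot {n : ℕ} {lam : ℝ} [IsFiniteMeasure (bergmanMeasure n lam)] (i : Fin n)
    (d : ℕ) {F : Cn n → ℂ} (hm : Measurable F) (hF : Integrable F (bergmanMeasure n lam)) :
    Integrable (fun x : Cn n × ℝ => ((Circle.exp x.2 : ℂ)⁻¹) ^ d * F (rot i (Circle.exp x.2) x.1))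
      ((bergmanMeasure n lam).prod (volume.restrict (Set.Ioc 0 (2 * Real.pi)))) := by
  have hcirc : Continuous fun θ : ℝ => (Circle.exp θ : ℂ) := by fun_prop
  have hcinv : Continuous fun θ : ℝ => ((Circle.exp θ : ℂ)⁻¹) ^ d :=
    (hcirc.inv₀ fun θ => Circle.coe_ne_zero _).pow d
  exact integrable_prod_family hcinv (fun θ => by simp) hcirc i hm
    (fun θ => integrable_rot i _ hF) (fun θ => integral_rot i _ fun z => ‖F z‖)

theorem integrable_coordComponent_of_measurable {n : ℕ} {lam : ℝ}
    [IsFiniteMeasure (bergmanMeasure n lam)] (i : Fin n) (d : ℕ) {F : Cn n → ℂ}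
    (hm : Measurable F) (hF : Integrable F (bergmanMeasure n lam)) :
    Integrable (coordComponent i d F) (bergmanMeasure n lam) :=
  (integrable_prod_rot i d hm hF).integral_prod_left.const_mul _

theorem integral_coordComponent_zero {n : ℕ} {lam : ℝ}
    [IsFiniteMeasure (bergmanMeasure n lam)] (i : Fin n) {F : Cn n → ℂ}
    (hm : Measurable F) (hF : Integrable F (bergmanMeasure n lam)) :
    ∫ z, coordComponent i 0 F z ∂(bergmanMeasure n lam) = ∫ z, F z ∂(bergmanMeasure n lam) := by
  unfold coordComponent discCoeff
  rw [integral_const_mul, integral_integral_swap (integrable_prod_rot i 0 hm hF)]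
  have : ∀ θ : ℝ, ∫ z, ((Circle.exp θ : ℂ)⁻¹) ^ 0 * F (rot i (Circle.exp θ) z)
      ∂(bergmanMeasure n lam) = ∫ z, F z ∂(bergmanMeasure n lam) := by
    intro θ
    simp only [pow_zero, one_mul]
    exact integral_rot i _ F
  simp only [this]
  have hpi : (Real.pi : ℂ) ≠ 0 := by exact_mod_cast Real.pi_ne_zero
  rw [setIntegral_const, Real.volume_real_Ioc_of_le (by positivity), Complex.real_smul]
  push_cast
  field_simp
  ring

theorem conj_mon_mul_coordComponent {n : ℕ} (i : Fin n) {d : ℕ} {β : Fin n → ℕ} (hβ : β i = d)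
    (F : Cn n → ℂ) (z : Cn n) : conj (mon β z) * coordComponent i d F z =
      coordComponent i 0 (fun z => conj (mon β z) * F z) z := by
  unfold coordComponent discCoeff
  rw [mul_left_comm, ← integral_const_mul]
  congr 2
  ext θ
  change _ = ((Circle.exp θ : ℂ)⁻¹) ^ 0 *
    (conj (mon β (rot i (Circle.exp θ) z)) * F (rot i (Circle.exp θ) z))
  rw [mon_rot, hβ, map_mul, map_pow, ← Circle.coe_inv_eq_conj, Circle.coe_inv]
  ring

theorem coordComponent_congr {n : ℕ} (i : Fin n) (d : ℕ) {f g : Cn n → ℂ}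
    (h : Set.EqOn f g (unitBall n)) :
    Set.EqOn (coordComponent i d f) (coordComponent i d g) (unitBall n) := fun _ hz =>
  discCoeff_congr d fun t => h (rot_mem_unitBall i (Circle.norm_coe t).le hz)

/-- The homogeneous component of degree `d` in the `i`-th coordinate has the same inner products as
`f` with all monomials of degree `d` in this coordinate: the measure is invariant under rotations
of the coordinate, so Fubini applies. -/
theorem integral_conj_mon_mul_coordComponent {n : ℕ} {lam : ℝ}
    [IsFiniteMeasure (bergmanMeasure n lam)] (i : Fin n) (d : ℕ) {f : Cn n → ℂ}
    (hf : DifferentiableOn ℂ f (unitBall n)) (hfi : Integrable f (bergmanMeasure n lam)) :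
    Integrable (coordComponent i d f) (bergmanMeasure n lam) ∧ ∀ β : Fin n → ℕ, β i = d →
      ∫ z, conj (mon β z) * coordComponent i d f z ∂(bergmanMeasure n lam) =
        ∫ z, conj (mon β z) * f z ∂(bergmanMeasure n lam) := by
  classical
  set F : Cn n → ℂ := (unitBall n).piecewise f 0 with hFdef
  have hm : Measurable F :=
    hf.continuousOn.measurable_piecewise continuousOn_const (measurableSet_unitBall n)
  have hEq : Set.EqOn F f (unitBall n) := Set.piecewise_eqOn _ _ _
  have hae : F =ᵐ[bergmanMeasure n lam] f := by
    filter_upwards [ae_mem_unitBall n lam] with z hz using hEq hz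
  have hcae : coordComponent i d F =ᵐ[bergmanMeasure n lam] coordComponent i d f := by
    filter_upwards [ae_mem_unitBall n lam] with z hz using coordComponent_congr i d hEq hz
  have hF : Integrable F (bergmanMeasure n lam) := hfi.congr hae.symm
  refine ⟨(integrable_coordComponent_of_measurable i d hm hF).congr hcae, fun β hβ => ?_⟩
  obtain ⟨C, hC⟩ := exists_bound_of_continuous lam (continuous_mon β)
  have hmon : Continuous fun z => conj (mon β z) := (continuous_mon β).star
  have hint : Integrable (fun z => conj (mon β z) * F z) (bergmanMeasure n lam) :=
    hF.bdd_mul (c := C) hmon.aestronglyMeasurable (by simpa using hC)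
  calc ∫ z, conj (mon β z) * coordComponent i d f z ∂(bergmanMeasure n lam)
      = ∫ z, conj (mon β z) * coordComponent i d F z ∂(bergmanMeasure n lam) := by
        refine integral_congr_ae ?_
        filter_upwards [hcae] with z hz
        rw [hz]
    _ = ∫ z, conj (mon β z) * F z ∂(bergmanMeasure n lam) := by
        simp only [conj_mon_mul_coordComponent i hβ]
        exact integral_coordComponent_zero i (hmon.measurable.mul hm) hint
    _ = _ := by
        refine integral_congr_ae ?_
        filter_upwards [hae] with z hz
        rw [hz]

/-! ### Completeness of the monomials -/

/-- Successive passage to homogeneous components in the coordinates of `S`, chosen so that the value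
at `z₀` stays nonzero. -/
theorem exists_homogeneous_component {n : ℕ} {lam : ℝ} [IsFiniteMeasure (bergmanMeasure n lam)]
    {f : Cn n → ℂ} (hf : DifferentiableOn ℂ f (unitBall n))
    (hfi : Integrable f (bergmanMeasure n lam)) {z₀ : Cn n} (hz₀ : z₀ ∈ unitBall n)
    (h0 : f z₀ ≠ 0) (S : Finset (Fin n)) :
    ∃ (α : Fin n → ℕ) (g : Cn n → ℂ), DifferentiableOn ℂ g (unitBall n) ∧
      Integrable g (bergmanMeasure n lam) ∧ g z₀ ≠ 0 ∧
      (∀ i ∈ S, ∀ ζ : ℂ, ‖ζ‖ ≤ 1 → ∀ z ∈ unitBall n, g (rot i ζ z) = ζ ^ α i * g z) ∧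
      ∀ β : Fin n → ℕ, (∀ i ∈ S, β i = α i) →
        ∫ z, conj (mon β z) * g z ∂(bergmanMeasure n lam) =
          ∫ z, conj (mon β z) * f z ∂(bergmanMeasure n lam) := by
  induction S using Finset.induction_on with
  | empty => exact ⟨0, f, hf, hfi, h0, by simp, fun _ _ => rfl⟩
  | insert i S hi ih =>
    obtain ⟨α, g, hg, hgi, hg0, hhom, hint⟩ := ih
    obtain ⟨d, hd⟩ := exists_coordComponent_ne_zero i hg hz₀ hg0
    obtain ⟨h1, h2⟩ := integral_conj_mon_mul_coordComponent i d hg hgi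
    have hne : ∀ j ∈ S, j ≠ i := fun j hj hji => hi (hji ▸ hj)
    refine ⟨Function.update α i d, coordComponent i d g, differentiableOn_coordComponent i d hg,
      h1, hd, fun j hj ζ hζ z hz => ?_, fun β hβ => ?_⟩
    · rcases Finset.mem_insert.1 hj with rfl | hj
      · rw [Function.update_self]
        exact coordComponent_rot_self j d hg hz hζ
      · rw [Function.update_of_ne (hne j hj)]
        exact coordComponent_rot_of_homogeneous i j d _ (hhom j hj ζ hζ) hz
    · rw [h2 β (by simpa using hβ i (Finset.mem_insert_self i S))]
      refine hint β fun j hj => ?_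
      simpa [hne j hj] using hβ j (Finset.mem_insert_of_mem hj)

/-- Homogeneity in each coordinate gives homogeneity under multiplication by points of the closed
polydisc. -/
theorem homogeneous_polydisc {n : ℕ} {α : Fin n → ℕ} {g : Cn n → ℂ}
    (hg : ∀ i, ∀ ζ : ℂ, ‖ζ‖ ≤ 1 → ∀ z ∈ unitBall n, g (rot i ζ z) = ζ ^ α i * g z)
    {ζ : Fin n → ℂ} (hζ : ∀ i, ‖ζ i‖ ≤ 1) {z : Cn n} (hz : z ∈ unitBall n) :
    g (WithLp.toLp 2 fun i => ζ i * z i) = (∏ i, ζ i ^ α i) * g z := by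
  suffices h : ∀ S : Finset (Fin n), ∃ w ∈ unitBall n,
      (∀ i, w i = if i ∈ S then ζ i * z i else z i) ∧ g w = (∏ i ∈ S, ζ i ^ α i) * g z by
    obtain ⟨w, -, hw, hgw⟩ := h Finset.univ
    rw [← hgw]
    congr 1
    ext i
    simp [hw]
  intro S
  induction S using Finset.induction_on with
  | empty => exact ⟨z, hz, by simp, by simp⟩
  | insert i S hi ih =>
    obtain ⟨w, hwb, hw, hgw⟩ := ih
    refine ⟨rot i (ζ i) w, rot_mem_unitBall i (hζ i) hwb, fun j => ?_, ?_⟩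
    · rw [rot_apply, hw]
      by_cases hj : j = i
      · subst hj
        simp [hi]
      · simp [hj]
    · rw [hg i _ (hζ i) w hwb, hgw, Finset.prod_insert hi, mul_assoc]

/-- A function on the ball that is homogeneous in each coordinate is a multiple of a monomial. -/
theorem eq_const_mul_mon {n : ℕ} {α : Fin n → ℕ} {g : Cn n → ℂ}
    (hg : ∀ i, ∀ ζ : ℂ, ‖ζ‖ ≤ 1 → ∀ z ∈ unitBall n, g (rot i ζ z) = ζ ^ α i * g z) :
    ∃ c : ℂ, ∀ z ∈ unitBall n, g z = c * mon α z := by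
  set ρ : ℂ := (((n + 1 : ℝ)⁻¹ : ℝ) : ℂ) with hρ
  have hn : (0 : ℝ) < (n + 1 : ℝ)⁻¹ := by positivity
  have hρ0 : ρ ≠ 0 := by
    rw [hρ]
    exact_mod_cast hn.ne'
  have hρ1 : ‖ρ‖ ≤ 1 := by
    rw [hρ, Complex.norm_real, Real.norm_of_nonneg (by positivity)]
    exact inv_le_one_of_one_le₀ (by linarith [(Nat.cast_nonneg n : (0 : ℝ) ≤ n)])
  set r : Cn n := WithLp.toLp 2 fun _ => ρ with hr
  have hrb : r ∈ unitBall n := by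
    have := const_mem_unitBall n
    rw [hr, hρ]
    push_cast at this ⊢
    exact this
  refine ⟨(∏ i, ρ ^ α i)⁻¹ * g r, fun z hz => ?_⟩
  -- `ρ z` is both the multiple of `z` by the polydisc point `(ρ, …, ρ)` and the multiple of
  -- `r = (ρ, …, ρ)` by the polydisc point `z`; homogeneity gives its value in both ways
  have h1 := homogeneous_polydisc hg (ζ := fun _ => ρ) (fun _ => hρ1) hz
  have h2 := homogeneous_polydisc hg (ζ := fun i => z i)
    (fun i => (PiLp.norm_apply_le z i).trans (mem_unitBall.1 hz).le) hrb
  have h3 : (WithLp.toLp 2 fun i => z i * r i : Cn n) = WithLp.toLp 2 fun i => ρ * z i := by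
    ext i
    simp [hr, mul_comm]
  rw [h3, h1] at h2
  have h4 : (∏ i, ρ ^ α i) ≠ 0 := Finset.prod_ne_zero_iff.2 fun i _ => pow_ne_zero _ hρ0
  rw [mul_assoc, eq_inv_mul_iff_mul_eq₀ h4, h2, mul_comm]
  rfl

theorem eqOn_zero_of_integral_conj_mon_eq_zero {n : ℕ} (hn : n ≠ 0) {lam : ℝ} (hlam : -1 < lam)
    {f : Cn n → ℂ} (hf : DifferentiableOn ℂ f (unitBall n))
    (hfi : Integrable f (bergmanMeasure n lam))
    (h : ∀ α, ∫ z, conj (mon α z) * f z ∂(bergmanMeasure n lam) = 0) :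
    Set.EqOn f 0 (unitBall n) := by
  have := isFiniteMeasure_bergmanMeasure hn hlam
  intro z₀ hz₀
  by_contra h0
  obtain ⟨α, g, hg, hgi, hg0, hhom, hint⟩ :=
    exists_homogeneous_component hf hfi hz₀ h0 Finset.univ
  obtain ⟨c, hc⟩ := eq_const_mul_mon fun i => hhom i (Finset.mem_univ i)
  have hc0 : c ≠ 0 := by
    rintro rfl
    exact hg0 (by rw [hc z₀ hz₀, zero_mul])
  have h1 := hint α fun _ _ => rfl
  rw [h α] at h1
  have h2 : ∫ z, conj (mon α z) * g z ∂(bergmanMeasure n lam) =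
      c * symbolForm lam 1 (mon α) (mon α) := by
    rw [symbolForm, ← integral_const_mul]
    refine integral_congr_ae ?_
    filter_upwards [ae_mem_unitBall n lam] with z hz
    rw [hc z hz, Pi.one_apply]
    ring
  rw [h2] at h1
  exact mul_ne_zero hc0 (symbolForm_one_mon_self_ne_zero hn hlam α) h1

/-! ### Matrix entries of Toeplitz operators -/

theorem memLp_mon {n : ℕ} (hn : n ≠ 0) {lam : ℝ} (hlam : -1 < lam) (α : Fin n → ℕ) :
    MemLp (mon α) 2 (bergmanMeasure n lam) := by
  have := isFiniteMeasure_bergmanMeasure hn hlam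
  obtain ⟨C, hC⟩ := exists_bound_of_continuous lam (continuous_mon α)
  exact MemLp.of_bound (continuous_mon α).aestronglyMeasurable C hC

/-- The monomials as elements of the Bergman space. -/
def monVec {n : ℕ} (hn : n ≠ 0) {lam : ℝ} (hlam : -1 < lam) (α : Fin n → ℕ) :
    bergmanSpace n lam :=
  ⟨(memLp_mon hn hlam α).toLp, mon α, (differentiable_mon α).differentiableOn,
    (memLp_mon hn hlam α).coeFn_toLp⟩

theorem inner_monVec {n : ℕ} (hn : n ≠ 0) {lam : ℝ} (hlam : -1 < lam) (α : Fin n → ℕ)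
    (f : Lp ℂ 2 (bergmanMeasure n lam)) :
    inner ℂ (monVec hn hlam α : Lp ℂ 2 (bergmanMeasure n lam)) f =
      ∫ z, conj (mon α z) * f z ∂(bergmanMeasure n lam) := by
  rw [L2.inner_def]
  refine integral_congr_ae ?_
  filter_upwards [(memLp_mon hn hlam α).coeFn_toLp] with z hz
  rw [monVec, hz, RCLike.inner_apply, mul_comm]

theorem inner_monVec_toeplitz_monVec {n : ℕ} (hn : n ≠ 0) {lam : ℝ} (hlam : -1 < lam)
    (a : BallSymbol n) (γ α : Fin n → ℕ) :
    inner ℂ (monVec hn hlam γ) (toeplitz lam a (monVec hn hlam α)) =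
      symbolForm lam a (mon γ) (mon α) := by
  have h1 : inner ℂ (monVec hn hlam γ) (toeplitz lam a (monVec hn hlam α)) =
      inner ℂ (monVec hn hlam γ : Lp ℂ 2 (bergmanMeasure n lam))
        (mulSymbol lam a (monVec hn hlam α)) :=
    Submodule.inner_orthogonalProjectionOnto_eq_of_mem_left _ _
  rw [h1, inner_monVec, symbolForm]
  refine integral_congr_ae ?_
  have h2 : mulSymbol lam a (monVec hn hlam α) =ᵐ[bergmanMeasure n lam] fun z =>
      ((a.memLp lam).toLp a) z *
        (monVec hn hlam α : Lp ℂ 2 (bergmanMeasure n lam)) z :=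
    ContinuousLinearMap.coeFn_holder _ _ _
  filter_upwards [h2, (memLp_mon hn hlam α).coeFn_toLp, (a.memLp lam).coeFn_toLp] with z e1 e2 e3
  rw [e1, e3, monVec, e2]

theorem inner_monVec_monVec {n : ℕ} (hn : n ≠ 0) {lam : ℝ} (hlam : -1 < lam) (γ α : Fin n → ℕ) :
    inner ℂ (monVec hn hlam γ) (monVec hn hlam α) = symbolForm lam 1 (mon γ) (mon α) := by
  rw [Submodule.coe_inner, inner_monVec, symbolForm]
  refine integral_congr_ae ?_
  filter_upwards [(memLp_mon hn hlam α).coeFn_toLp] with z hz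
  rw [monVec, hz, Pi.one_apply, one_mul]

theorem eq_zero_of_inner_monVec_eq_zero {n : ℕ} (hn : n ≠ 0) {lam : ℝ} (hlam : -1 < lam)
    {F : bergmanSpace n lam} (h : ∀ α, inner ℂ (monVec hn hlam α) F = 0) : F = 0 := by
  have := isFiniteMeasure_bergmanMeasure hn hlam
  obtain ⟨F, f, hf, hFf⟩ := F
  have hfi : Integrable f (bergmanMeasure n lam) :=
    ((Lp.memLp F).integrable one_le_two).congr hFf
  have h0 : Set.EqOn f 0 (unitBall n) := by
    refine eqOn_zero_of_integral_conj_mon_eq_zero hn hlam hf hfi fun α => ?_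
    have h1 := h α
    rw [Submodule.coe_inner, inner_monVec] at h1
    rw [← h1]
    refine integral_congr_ae ?_
    filter_upwards [hFf] with z hz
    rw [hz]
  apply Subtype.ext
  rw [Submodule.coe_zero, Lp.eq_zero_iff_ae_eq_zero]
  filter_upwards [hFf, ae_mem_unitBall n lam] with z h1 h2
  rw [h1, h0 h2]

/-! ### Operators with sparse matrices in an orthogonal system -/

section OrthogonalSystem

variable {ι H : Type*} [NormedAddCommGroup H] [InnerProductSpace ℂ H] [CompleteSpace H]

/-- If the sum over `j` giving the matrix entry of `S T` at `(k, i)` in a complete orthogonal system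
has at most one nonzero term, then this term is the entry. -/
theorem inner_comp_eq_of_orthogonal {e : ι → H}
    (horth : ∀ i j, i ≠ j → inner ℂ (e i) (e j) = 0) (hne : ∀ i, inner ℂ (e i) (e i) ≠ 0)
    (hcomplete : ∀ x, (∀ i, inner ℂ (e i) x = 0) → x = 0) (S T : H →L[ℂ] H) {k i j₀ : ι}
    (h : ∀ j, j ≠ j₀ → inner ℂ (e k) (S (e j)) * inner ℂ (e j) (T (e i)) = 0) :
    inner ℂ (e k) (S (T (e i))) * inner ℂ (e j₀) (e j₀) =
      inner ℂ (e k) (S (e j₀)) * inner ℂ (e j₀) (T (e i)) := by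
  have hnorm : ∀ i, (‖e i‖ : ℂ) ≠ 0 := fun i h0 => hne i (by
    rw [inner_self_eq_norm_sq_to_K]
    simpa using h0)
  set v : ι → H := fun i => ((‖e i‖ : ℂ)⁻¹) • e i with hv
  have hvo : Orthonormal ℂ v := by
    refine ⟨fun i => ?_, fun i j hij => ?_⟩
    · have := hnorm i
      rw [hv, norm_smul, norm_inv, Complex.norm_real, norm_norm, inv_mul_cancel₀]
      exact_mod_cast this
    · simp [hv, inner_smul_left, inner_smul_right, horth i j hij]
  have hbot : (Submodule.span ℂ (Set.range v))ᗮ = ⊥ := by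
    rw [Submodule.eq_bot_iff]
    intro x hx
    refine hcomplete x fun i => ?_
    have h1 := (Submodule.mem_orthogonal _ _).1 hx (v i) (Submodule.subset_span ⟨i, rfl⟩)
    rw [hv, inner_smul_left] at h1
    exact (mul_eq_zero.1 h1).resolve_left (by simpa using hnorm i)
  set b := HilbertBasis.mkOfOrthogonalEqBot hvo hbot
  have hb : ∀ j, b j = ((‖e j‖ : ℂ)⁻¹) • e j := fun j => by
    rw [HilbertBasis.coe_mkOfOrthogonalEqBot]
  have hs := b.hasSum_inner_mul_inner (ContinuousLinearMap.adjoint S (e k)) (T (e i))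
  simp only [ContinuousLinearMap.adjoint_inner_left, hb, inner_smul_left,
    inner_smul_right] at hs
  have hs' := hs.unique (hasSum_single j₀ fun j hj => by
    rw [mul_mul_mul_comm, h j hj, mul_zero])
  rw [hs', inner_self_eq_norm_sq_to_K]
  have := hnorm j₀
  simp only [map_inv₀, Complex.conj_ofReal, Complex.coe_algebraMap]
  field_simp

theorem eq_of_inner_eq {e : ι → H} (hcomplete : ∀ x, (∀ i, inner ℂ (e i) x = 0) → x = 0)
    {S T : H →L[ℂ] H} (h : ∀ k i, inner ℂ (e k) (S (e i)) = inner ℂ (e k) (T (e i))) :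
    S = T := by
  have hdense : (Submodule.span ℂ (Set.range e)).topologicalClosure = ⊤ := by
    rw [Submodule.topologicalClosure_eq_top_iff, Submodule.eq_bot_iff]
    exact fun x hx => hcomplete x fun i =>
      (Submodule.mem_orthogonal _ _).1 hx (e i) (Submodule.subset_span ⟨i, rfl⟩)
  refine ContinuousLinearMap.ext_on (s := Set.range e)
    (Submodule.dense_iff_topologicalClosure_eq_top.2 hdense) ?_
  rintro _ ⟨i, rfl⟩
  rw [← sub_eq_zero]
  refine hcomplete _ fun k => ?_
  rw [inner_sub_right, h, sub_self]

end OrthogonalSystem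

/-! ### Commutation -/

/-- Toeplitz operators commute if, for disjoint sets `s` and `t` of coordinates, the first symbol is
invariant under the torus elements that are constant on `s` and under the mixing matrix of `t`, and
the second one likewise with `s` and `t` exchanged. In the monomial basis the first operator acts
on the exponents in `s` only, by a matrix that depends on the exponents in `t` through their sum
only, and the second one acts on the exponents in `t` only. -/
theorem toeplitz_comm_of_invariantUnder {n : ℕ} (hn : n ≠ 0) {lam : ℝ} (hlam : -1 < lam)
    {a b : BallSymbol n} {s t : Finset (Fin n)} (hst : Disjoint s t) (hs : s.Nonempty)
    (ht : t.Nonempty)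
    (ha : ∀ p ∉ s, ∀ c, InvariantUnder lam (blockScalar {p} c) a)
    (ha' : ∀ c, InvariantUnder lam (blockScalar s c) a) (ham : InvariantUnder lam (mixUnitary t) a)
    (hb : ∀ p ∉ t, ∀ c, InvariantUnder lam (blockScalar {p} c) b)
    (hb' : ∀ c, InvariantUnder lam (blockScalar t c) b)
    (hbm : InvariantUnder lam (mixUnitary s) b) :
    toeplitz lam a ∘L toeplitz lam b = toeplitz lam b ∘L toeplitz lam a := by
  have hs_t : ∀ {p}, p ∈ s → p ∉ t := fun h => Finset.disjoint_left.1 hst h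
  have ht_s : ∀ {p}, p ∈ t → p ∉ s := fun h => Finset.disjoint_right.1 hst h
  have hat : BlockInvariant lam t a := ⟨a.memLp lam, fun p hp => ha p (ht_s hp), ham⟩
  have hbs : BlockInvariant lam s b := ⟨b.memLp lam, fun p hp => hb p (hs_t hp), hbm⟩
  have hcomplete : ∀ x : bergmanSpace n lam,
      (∀ α, inner ℂ (monVec hn hlam α) x = 0) → x = 0 :=
    fun x => eq_zero_of_inner_monVec_eq_zero hn hlam
  have ha0 : ∀ {α β : Fin n → ℕ} {p : Fin n}, p ∉ s → α p ≠ β p →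
      symbolForm lam a (mon α) (mon β) = 0 := fun hp h =>
    symbolForm_mon_eq_zero (ha _ hp) (by simpa using h)
  have hb0 : ∀ {α β : Fin n → ℕ} {p : Fin n}, p ∉ t → α p ≠ β p →
      symbolForm lam b (mon α) (mon β) = 0 := fun hp h =>
    symbolForm_mon_eq_zero (hb _ hp) (by simpa using h)
  have hcomp : ∀ (S T : bergmanSpace n lam →L[ℂ] bergmanSpace n lam) (γ α β : Fin n → ℕ),
      (∀ δ, δ ≠ β → inner ℂ (monVec hn hlam γ) (S (monVec hn hlam δ)) *
        inner ℂ (monVec hn hlam δ) (T (monVec hn hlam α)) = 0) →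
      inner ℂ (monVec hn hlam γ) (S (T (monVec hn hlam α))) *
          inner ℂ (monVec hn hlam β) (monVec hn hlam β) =
        inner ℂ (monVec hn hlam γ) (S (monVec hn hlam β)) *
          inner ℂ (monVec hn hlam β) (T (monVec hn hlam α)) := fun S T γ α β => inner_comp_eq_of_orthogonal (e := monVec hn hlam)
    (fun i j hij => by rw [inner_monVec_monVec, symbolForm_one_mon_of_ne hij])
    (fun i => by
      rw [inner_monVec_monVec]
      exact symbolForm_one_mon_self_ne_zero hn hlam i) hcomplete S T (k := γ) (i := α) (j₀ := β)
  refine eq_of_inner_eq hcomplete fun γ α => ?_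
  -- the intermediate exponents through which the two products pass from `α` to `γ`
  set β : Fin n → ℕ := t.piecewise γ α with hβ
  set β' : Fin n → ℕ := s.piecewise γ α with hβ'
  have h1 := hcomp (toeplitz lam a) (toeplitz lam b) γ α β fun δ hδ => by
    simp only [inner_monVec_toeplitz_monVec]
    obtain ⟨p, hp⟩ := Function.ne_iff.1 hδ
    by_cases hpt : p ∈ t
    · rw [ha0 (ht_s hpt) (by simpa [hβ, hpt] using hp.symm), zero_mul]
    · rw [hb0 hpt (by simpa [hβ, hpt] using hp), mul_zero]
  have h2 := hcomp (toeplitz lam b) (toeplitz lam a) γ α β' fun δ hδ => by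
    simp only [inner_monVec_toeplitz_monVec]
    obtain ⟨p, hp⟩ := Function.ne_iff.1 hδ
    by_cases hps : p ∈ s
    · rw [hb0 (hs_t hps) (by simpa [hβ', hps] using hp.symm), zero_mul]
    · rw [ha0 hps (by simpa [hβ', hps] using hp), mul_zero]
  simp only [inner_monVec_toeplitz_monVec, inner_monVec_monVec] at h1 h2
  have hpw : ∀ u : Finset (Fin n), u.piecewise α α = α := fun u => by
    ext p
    simp [Finset.piecewise]
  have hN := symbolForm_one_mon_self_ne_zero hn hlam β
  have hN' := symbolForm_one_mon_self_ne_zero hn hlam β'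
  simp only [ContinuousLinearMap.comp_apply]
  rw [← eq_div_iff hN] at h1
  rw [← eq_div_iff hN'] at h2
  rw [h1, h2]
  have hβs : ∀ p ∈ s, β p = α p := fun p hp => by simp [hβ, hs_t hp]
  have hβt : ∀ p ∈ t, β' p = α p := fun p hp => by simp [hβ', ht_s hp]
  by_cases hoff : ∃ p, p ∉ s ∧ p ∉ t ∧ γ p ≠ α p
  · obtain ⟨p, hps, hpt, hp⟩ := hoff
    rw [ha0 hps (α := γ) (β := β) (by simpa [hβ, hpt] using hp),
      hb0 hpt (α := γ) (β := β') (by simpa [hβ', hps] using hp)]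
    simp
  push Not at hoff
  by_cases hsum : ∑ p ∈ s, γ p = ∑ p ∈ s, α p
  swap
  · rw [symbolForm_mon_eq_zero ha' (α := γ) (β := β) (by rwa [Finset.sum_congr rfl hβs]),
      symbolForm_mon_eq_zero ha' (α := β') (β := α) (by
        rwa [Finset.sum_congr rfl fun p hp => by rw [hβ', Finset.piecewise_eq_of_mem _ _ _ hp]])]
    simp
  by_cases hsum' : ∑ p ∈ t, γ p = ∑ p ∈ t, α p
  swap
  · rw [symbolForm_mon_eq_zero hb' (α := γ) (β := β') (by rwa [Finset.sum_congr rfl hβt]),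
      symbolForm_mon_eq_zero hb' (α := β) (β := α) (by
        rwa [Finset.sum_congr rfl fun p hp => by rw [hβ, Finset.piecewise_eq_of_mem _ _ _ hp]])]
    simp
  -- comparison of the entries that differ only in the exponents of the inert block
  obtain ⟨R, hR0, hR⟩ := exists_symbolForm_eq hn hlam ht hsum'
  obtain ⟨Q, hQ0, hQ⟩ := exists_symbolForm_eq hn hlam hs hsum
  have e1 : t.piecewise γ β' = γ := by
    ext p
    by_cases hpt : p ∈ t
    · simp [hpt]
    · by_cases hps : p ∈ s
      · simp [hpt, hβ', hps]
      · simp [hpt, hβ', hps, hoff p hps hpt]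
  have e2 : t.piecewise α β' = β' := by
    ext p
    by_cases hpt : p ∈ t
    · simp [hpt, hβt p hpt]
    · simp [hpt]
  have e3 : s.piecewise γ β = γ := by
    ext p
    by_cases hps : p ∈ s
    · simp [hps]
    · by_cases hpt : p ∈ t
      · simp [hps, hβ, hpt]
      · simp [hpt, hβ, hps, hoff p hps hpt]
  have e4 : s.piecewise α β = β := by
    ext p
    by_cases hps : p ∈ s
    · simp [hps, hβs p hps]
    · simp [hps]
  have k1 := hR a hat β' α
  have k2 := hR 1 (blockInvariant_one hn hlam t) α α
  have k3 := hQ b hbs β α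
  have k4 := hQ 1 (blockInvariant_one hn hlam s) α α
  rw [e1, e2, hpw, ← hβ] at k1
  rw [e3, e4, hpw, ← hβ'] at k3
  rw [hpw, ← hβ] at k2
  rw [hpw, ← hβ'] at k4
  have hNα := symbolForm_one_mon_self_ne_zero hn hlam α
  rw [k1, k2, k3, k4]
  field_simp

/-! ### Block diagonal unitary matrices -/

/-- The set of coordinates that belong to the `j`-th block. -/
def block {n : ℕ} (k : Composition n) (j : Fin k.length) : Finset (Fin n) :=
  Finset.univ.map (k.embedding j).toEmbedding

theorem embedding_mem_block {n : ℕ} (k : Composition n) (i j : Fin k.length)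
    (x : Fin (k.blocksFun i)) : k.embedding i x ∈ block k j ↔ i = j := by
  constructor
  · intro h
    obtain ⟨y, -, hy⟩ := Finset.mem_map.1 h
    have := congrArg k.index hy
    simpa using this.symm
  · rintro rfl
    exact Finset.mem_map_of_mem _ (Finset.mem_univ x)

theorem card_block {n : ℕ} (k : Composition n) (j : Fin k.length) :
    (block k j).card = k.blocksFun j := by
  simp [block]

theorem block_nonempty {n : ℕ} (k : Composition n) (j : Fin k.length) : (block k j).Nonempty := by
  rw [← Finset.card_pos, card_block]
  exact k.one_le_blocksFun j

theorem disjoint_block {n : ℕ} (k : Composition n) {i j : Fin k.length} (h : i ≠ j) :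
    Disjoint (block k i) (block k j) := by
  rw [Finset.disjoint_left]
  intro p hp
  obtain ⟨x, -, rfl⟩ := Finset.mem_map.1 hp
  exact fun hx => h ((embedding_mem_block k i j x).1 hx)

theorem blockEmbed_eq_of_entries {n : ℕ} (k : Composition n)
    (B : ∀ i : Fin k.length, Matrix.unitaryGroup (Fin (k.blocksFun i)) ℂ)
    (A : Matrix.unitaryGroup (Fin n) ℂ)
    (h : ∀ i x y, (A : Matrix (Fin n) (Fin n) ℂ) (k.embedding i x) (k.embedding i y) =
      (B i : Matrix (Fin (k.blocksFun i)) (Fin (k.blocksFun i)) ℂ) x y)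
    (h0 : ∀ i j x y, i ≠ j →
      (A : Matrix (Fin n) (Fin n) ℂ) (k.embedding i x) (k.embedding j y) = 0) :
    blockEmbed k B = A := by
  apply Subtype.ext
  ext p q
  obtain ⟨⟨i, x⟩, rfl⟩ := k.blocksFinEquiv.surjective p
  obtain ⟨⟨j, y⟩, rfl⟩ := k.blocksFinEquiv.surjective q
  change (Matrix.blockDiagonal' fun i =>
    (B i : Matrix (Fin (k.blocksFun i)) (Fin (k.blocksFun i)) ℂ))
    (k.blocksFinEquiv.symm (k.blocksFinEquiv ⟨i, x⟩))
    (k.blocksFinEquiv.symm (k.blocksFinEquiv ⟨j, y⟩)) =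
    (A : Matrix (Fin n) (Fin n) ℂ) (k.embedding i x) (k.embedding j y)
  rw [Equiv.symm_apply_apply, Equiv.symm_apply_apply]
  by_cases hij : i = j
  · subst hij
    rw [Matrix.blockDiagonal'_apply_eq, h]
  · rw [Matrix.blockDiagonal'_apply_ne _ _ _ hij, h0 _ _ _ _ hij]

theorem diagUnitary_mem_blockGroup {n : ℕ} (k : Composition n) (j : Fin k.length)
    (t : Fin n → Circle) (c : Circle) (ht : ∀ p ∈ block k j, t p = c) :
    diagUnitary t ∈ blockGroup k j := by
  refine Subgroup.mem_map.2 ⟨fun i => diagUnitary fun x => t (k.embedding i x), ?_, ?_⟩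
  · rw [Subgroup.mem_pi]
    intro i hi
    rw [Set.mem_singleton_iff] at hi
    subst hi
    refine ⟨c, Subtype.ext ?_⟩
    change (c : ℂ) • (1 : Matrix (Fin (k.blocksFun i)) (Fin (k.blocksFun i)) ℂ) =
      Matrix.diagonal fun x => (t (k.embedding i x) : ℂ)
    rw [Matrix.smul_one_eq_diagonal]
    congr 1
    ext x
    rw [ht _ ((embedding_mem_block k i i x).2 rfl)]
  · refine blockEmbed_eq_of_entries k _ _ (fun i x y => ?_) fun i j x y hij => ?_
    · by_cases h : x = y <;> simp [diagUnitary, h]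
    · refine Matrix.diagonal_apply_ne _ fun h => hij ?_
      simpa using congrArg k.index h

theorem mixUnitary_mem_blockGroup {n : ℕ} (k : Composition n) {i j : Fin k.length} (hij : i ≠ j) :
    mixUnitary (block k i) ∈ blockGroup k j := by
  refine Subgroup.mem_map.2 ⟨Pi.mulSingle i (mixUnitary Finset.univ), ?_, ?_⟩
  · rw [Subgroup.mem_pi]
    intro l hl
    rw [Set.mem_singleton_iff] at hl
    subst hl
    rw [Pi.mulSingle_eq_of_ne hij.symm]
    exact one_mem _
  · refine blockEmbed_eq_of_entries k _ _ (fun l x y => ?_) fun l m x y hlm => ?_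
    · by_cases hl : l = i
      · subst hl
        simp [mixUnitary, mixMatrix, avgMatrix, embedding_mem_block, card_block, Matrix.one_apply]
      · simp [mixUnitary, mixMatrix, avgMatrix, embedding_mem_block, hl, Matrix.one_apply]
    · have hne : k.embedding l x ≠ k.embedding m y := fun h => hlm (by
        simpa using congrArg k.index h)
      have : ¬(l = i ∧ m = i) := fun h => hlm (h.1.trans h.2.symm)
      simp [mixUnitary, mixMatrix, avgMatrix, embedding_mem_block, this, hne]

theorem IsInvariantSymbol.invariantUnder {n : ℕ} {H : Subgroup (Matrix.unitaryGroup (Fin n) ℂ)}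
    {a : BallSymbol n} (ha : IsInvariantSymbol H a) (lam : ℝ)
    {A : Matrix.unitaryGroup (Fin n) ℂ} (hA : A ∈ H) : InvariantUnder lam A a :=
  (bergmanMeasure_absolutelyContinuous n lam).ae_le (ha A hA)

theorem blockScalar_singleton_mem_blockGroup {n : ℕ} (k : Composition n) {j : Fin k.length}
    {p : Fin n} (hp : p ∉ block k j) (c : Circle) : blockScalar {p} c ∈ blockGroup k j :=
  diagUnitary_mem_blockGroup k j _ 1 fun q hq => by
    rw [if_neg]
    rw [Finset.mem_singleton]
    rintro rfl
    exact hp hq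

theorem blockScalar_block_mem_blockGroup {n : ℕ} (k : Composition n) (j : Fin k.length)
    (c : Circle) : blockScalar (block k j) c ∈ blockGroup k j :=
  diagUnitary_mem_blockGroup k j _ c fun _ hq => if_pos hq

end BallToeplitz
end

open BallToeplitz

theorem mainTheorem1 {n : ℕ} (k : Composition n) (hk : 2 ≤ k.length)
    (j₁ j₂ : Fin k.length) (hj : j₁ ≠ j₂) (a b : BallSymbol n)
    (ha : IsInvariantSymbol (blockGroup k j₁) a)
    (hb : IsInvariantSymbol (blockGroup k j₂) b)
    (lam : ℝ) (hlam : -1 < lam) :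
    toeplitz lam a ∘L toeplitz lam b = toeplitz lam b ∘L toeplitz lam a := by
  have hn : n ≠ 0 := by
    have := k.length_le
    lia
  exact toeplitz_comm_of_invariantUnder hn hlam (disjoint_block k hj) (block_nonempty k j₁)
    (block_nonempty k j₂)
    (fun p hp c => ha.invariantUnder lam (blockScalar_singleton_mem_blockGroup k hp c))
    (fun c => ha.invariantUnder lam (blockScalar_block_mem_blockGroup k j₁ c))
    (ha.invariantUnder lam (mixUnitary_mem_blockGroup k hj.symm))
    (fun p hp c => hb.invariantUnder lam (blockScalar_singleton_mem_blockGroup k hp c))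
    (fun c => hb.invariantUnder lam (blockScalar_block_mem_blockGroup k j₂ c))
    (hb.invariantUnder lam (mixUnitary_mem_blockGroup k hj))
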